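/- Let $U\subseteq\mathbb R^2$ be an open coordinate domain with a smooth metric $g_{ab}$ (symmetric, $\det g\neq 0$, of either signature), Levi-Civita connection $\Gamma^a_{bc}$ and curvature $R_{abcd}=g_{ae}R^e{}_{bcd}$, where $R^a{}_{bcd}=\partial_c\Gamma^a_{bd}-\partial_d\Gamma^a_{bc}+\Gamma^a_{ce}\Gamma^e_{bd}-\Gamma^a_{de}\Gamma^e_{bc}$. For an unknown tensor $L_{abc}$ with $L_{abc}=L_{[ab]c}$ and $L_{[abc]}=0$ (two independent components) consider the first-order linear systems (A) the Riemann–Lanczos equations $R_{abcd}=L_{abc;d}-L_{abd;c}+L_{cda;b}-L_{cdb;a}$; (B) the equations of (A) together with the differential gauge condition $L_{ab}{}^{s}{}_{;s}=0$. Write either system as $\Phi(x,u,\partial u)=0$ with $u=(u^1,\dots,u^m)$, $m=2$, $x\in U\subseteq\mathbb R^n$, $n=2$. *Involution as a PDE system.* For $r\ge 0$ let $\mathcal R_{1+r}$ be the set of $(1+r)$-jets at points of $U$ that satisfy the equations and all their derivatives of order at most $r$. Let $\mathcal M_1$ be the symbol, i.e. the space of $V^\alpha_i$ with $\sum \frac{\partial\Phi}{\partial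 u^\alpha_{,i}}V^\alpha_i=0$, and $\mathcal M_2$ its prolongation, i.e. the space of symmetric $V^\alpha_{ik}$ with $V^\alpha_{i\,\cdot}\in\mathcal M_1$ for each $i$. With respect to a basis of $\mathbb R^n$, let $\beta^{(k+1)}+\dots+\beta^{(n)}$ be the rank of the columns of the symbol matrix that belong to derivatives in the last $n-k$ directions ($0\le k<n$), and let $\alpha^{(k)}=m-\beta^{(k)}$; the basis is $\delta$-regular if all these ranks are maximal among all bases. The symbol is involutive if $\dim\mathcal M_2=\sum_k k\,\alpha^{(k)}$ in a $\delta$-regular basis. The system is formally integrable if the projection $\mathcal R_{2+r}\to\mathcal R_{1+r}$ is onto for every $r\ge0$. It is involutive if $\mathcal R_1\to U$ is onto, the symbol is involutive at every point of $\mathcal R_1$, and the system is formally integrable. *Involution as an exterior differential system.* On the 8-dimensional bundle $J^1$ of 1-jets over $U$, with coordinates $(x^i,u^\alpha,p^\alpha_i)$, take the Pfaffian system generated by the components of $d\Phi$ and of $du^\alpha-p^\alpha_i\,dx^i$, together with their exterior derivatives. An integral element is a tangent subspace on which these forms all vanish; it is regular if the rank $c$ of its polar equations is constant on the integral elements of the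 same dimension near it. An integral element $E_n$ is ordinary if it has a flag $0=E_0\subset E_1\subset\dots\subset E_n$ with $E_0,\dots,E_{n-1}$ regular; the Cartan characters of the flag are $s_0=c(E_0)$ and $s_k=c(E_k)-c(E_{k-1})$. The system is in involution with respect to $x^1,\dots,x^n$ if through every point of $J^1$ over $U$ there is an ordinary $E_n$ on which $dx^1\wedge\dots\wedge dx^n\ne0$. **Proposition.** For every such $U$ and $g$, each of the systems (A) and (B) is involutive as a PDE system, and its Pfaffian system is in involution with respect to $x^1,x^2$. In every $\delta$-regular basis, at every point of $\mathcal R_1$, $(\alpha^{(1)},\alpha^{(2)})=(2,1)$ for (A) and $(2,0)$ for (B). For every flag exhibiting an ordinary integral element with $dx^1\wedge dx^2\neq0$, at every point of $J^1$ over $U$, the Cartan characters are $(s_0,s_1,s_2)=(3,2,1)$ for (A) and $(4,2,0)$ for (B). -/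

import Mathlib

open scoped ContDiff Topology

noncomputable section

/-! ### Jets and first-order systems of partial differential equations

A first-order system for unknowns `u : ℝⁿ → F` is a map `Φ : J¹(ℝⁿ, F) → W`; the equation is
`Φ (x, u x, Du x) = 0` for `x` in the open set `U`. -/

/-- Coordinate space `ℝⁿ`. -/
abbrev Coord (n : ℕ) : Type := Fin n → ℝ

/-- The first jet bundle `J¹(ℝⁿ, F)` with coordinates (point, value, first derivative). -/
abbrev J1 (n : ℕ) (F : Type) [NormedAddCommGroup F] [NormedSpace ℝ F] : Type :=
  Coord n × F × (Coord n →L[ℝ] F)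

section PDE

variable {n : ℕ} {F W : Type} [NormedAddCommGroup F] [NormedSpace ℝ F]
  [NormedAddCommGroup W] [NormedSpace ℝ W]

/-- Families of derivatives of order `0, …, k`: the type in which `k`-jets at a point live. -/
abbrev JetFibre (n : ℕ) (F : Type) [NormedAddCommGroup F] [NormedSpace ℝ F] (k : ℕ) : Type :=
  (i : Fin (k + 1)) → ContinuousMultilinearMap ℝ (fun _ : Fin (i : ℕ) => Coord n) F

/-- The `k`-jet of `u` at `x`: all derivatives of order at most `k`. -/
def jetAt (k : ℕ) (u : Coord n → F) (x : Coord n) : JetFibre n F k :=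
  fun i => iteratedFDeriv ℝ (i : ℕ) u x

/-- The projection `π^{k+1}_k` from `(k+1)`-jets to `k`-jets. -/
def jetProj (k : ℕ) (j : Coord n × JetFibre n F (k + 1)) : Coord n × JetFibre n F k :=
  (j.1, fun i => j.2 i.castSucc)

/-- The function `x ↦ Φ (x, u x, Du x)`. -/
def evalSystem (Φ : J1 n F → W) (u : Coord n → F) (x : Coord n) : W :=
  Φ (x, u x, fderiv ℝ u x)

/-- The prolonged system `R_{1+r}`: the `(1+r)`-jets, at points of `U`, of smooth maps `u` that
satisfy the equations and all their derivatives up to order `r` at the point considered. -/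
def prolongedSystem (U : Set (Coord n)) (Φ : J1 n F → W) (r : ℕ) :
    Set (Coord n × JetFibre n F (r + 1)) :=
  {j | j.1 ∈ U ∧ ∃ u : Coord n → F, ContDiff ℝ ∞ u ∧ j.2 = jetAt (r + 1) u j.1 ∧
    ∀ i ≤ r, iteratedFDeriv ℝ i (evalSystem Φ u) j.1 = 0}

/-- Formal integrability: `R_{1+r}^{(1)} = R_{1+r}` for all `r ≥ 0`, where `R_{1+r}^{(1)}` is the
projection of `R_{2+r}`. -/
def FormallyIntegrable (U : Set (Coord n)) (Φ : J1 n F → W) : Prop :=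
  ∀ r : ℕ, jetProj (r + 1) '' prolongedSystem U Φ (r + 1) = prolongedSystem U Φ r

/-- The symbol map at a 1-jet: the derivative of `Φ` in the first-order derivatives alone. -/
def symbolMap (Φ : J1 n F → W) (j : J1 n F) : (Coord n →L[ℝ] F) →L[ℝ] W :=
  fderiv ℝ (fun P : Coord n →L[ℝ] F => Φ (j.1, j.2.1, P)) j.2.2

/-- The prolonged symbol `M_2` at a 1-jet: symmetric `V_{ik}` with `V_{i·}` in the symbol `M_1`
(the kernel of the symbol map) for every `i`. -/
def prolongedSymbol (Φ : J1 n F → W) (j : J1 n F) :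
    Submodule ℝ (Coord n →L[ℝ] Coord n →L[ℝ] F) where
  carrier := {B | (∀ v w, B v w = B w v) ∧ ∀ v, symbolMap Φ j (B v) = 0}
  zero_mem' := by simp
  add_mem' := by
    rintro A B ⟨hA, hA'⟩ ⟨hB, hB'⟩
    refine ⟨fun v w => ?_, fun v => ?_⟩
    · simp [hA v w, hB v w]
    · simp [hA' v, hB' v]
  smul_mem' := by
    rintro c A ⟨hA, hA'⟩
    refine ⟨fun v w => ?_, fun v => ?_⟩
    · simp [hA v w]
    · simp [hA' v]

/-- First derivatives that vanish in the first `k` directions of the basis `b`, i.e. those which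
involve only derivatives of class greater than `k`. -/
def derivsOfClassGT (F : Type) [NormedAddCommGroup F] [NormedSpace ℝ F]
    (b : Module.Basis (Fin n) ℝ (Coord n)) (k : ℕ) : Submodule ℝ (Coord n →L[ℝ] F) where
  carrier := {A | ∀ i : Fin n, (i : ℕ) < k → A (b i) = 0}
  zero_mem' := by simp
  add_mem' := by
    intro A B hA hB i hi
    simp [hA i hi, hB i hi]
  smul_mem' := by
    intro c A hA i hi
    simp [hA i hi]

/-- The rank of the columns of class greater than `k` of the symbol matrix. When the symbol is
solved for derivatives of the highest possible class, this is the number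
`β^{(k+1)} + ⋯ + β^{(n)}` of equations of class greater than `k`. -/
def rankOfClassGT (Φ : J1 n F → W) (j : J1 n F)
    (b : Module.Basis (Fin n) ℝ (Coord n)) (k : ℕ) : ℕ :=
  Module.finrank ℝ ((derivsOfClassGT F b k).map (symbolMap Φ j).toLinearMap)

/-- `β^{(k+1)}`, the number of equations of class `k + 1` of the symbol. -/
def betaClass (Φ : J1 n F → W) (j : J1 n F)
    (b : Module.Basis (Fin n) ℝ (Coord n)) (k : Fin n) : ℤ :=
  (rankOfClassGT Φ j b k : ℤ) - rankOfClassGT Φ j b (k + 1)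

/-- `α^{(k+1)} = m - β^{(k+1)}`, where `m` is the number of unknown functions. -/
def alphaClass (Φ : J1 n F → W) (j : J1 n F)
    (b : Module.Basis (Fin n) ℝ (Coord n)) (k : Fin n) : ℤ :=
  (Module.finrank ℝ F : ℤ) - betaClass Φ j b k

/-- `δ`-regularity of the frame `b`: all the sums `β^{(k+1)} + ⋯ + β^{(n)}` are maximal. -/
def IsDeltaRegular (Φ : J1 n F → W) (j : J1 n F)
    (b : Module.Basis (Fin n) ℝ (Coord n)) : Prop :=
  ∀ (b' : Module.Basis (Fin n) ℝ (Coord n)) (k : ℕ),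
    rankOfClassGT Φ j b' k ≤ rankOfClassGT Φ j b k

/-- The symbol is involutive at the 1-jet `j`: `dim M_2 = ∑ k α^{(k)}` in a `δ`-regular frame. -/
def HasInvolutiveSymbolAt (Φ : J1 n F → W) (j : J1 n F) : Prop :=
  ∃ b : Module.Basis (Fin n) ℝ (Coord n), IsDeltaRegular Φ j b ∧
    (Module.finrank ℝ (prolongedSymbol Φ j) : ℤ) = ∑ k : Fin n, ((k : ℤ) + 1) * alphaClass Φ j b k

/-- The system `Φ = 0` over `U` is involutive: there are 1-jets satisfying it over every point
of `U`, its symbol is involutive, and it is formally integrable. -/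
def IsInvolutiveSystem (U : Set (Coord n)) (Φ : J1 n F → W) : Prop :=
  (∀ x ∈ U, ∃ u P, Φ (x, u, P) = 0) ∧
  (∀ j : J1 n F, j.1 ∈ U → Φ j = 0 → HasInvolutiveSymbolAt Φ j) ∧
  FormallyIntegrable U Φ

/-- `(α^{(1)}, …, α^{(n)})` equals `a` at all 1-jets of the system, in every `δ`-regular frame. -/
def HasSymbolCharacters (U : Set (Coord n)) (Φ : J1 n F → W) (a : Fin n → ℤ) : Prop :=
  ∀ j : J1 n F, j.1 ∈ U → Φ j = 0 → ∀ b : Module.Basis (Fin n) ℝ (Coord n),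
    IsDeltaRegular Φ j b → ∀ k, alphaClass Φ j b k = a k

end PDE

/-! ### Exterior differential systems generated by 1-forms

A (vector-valued) 1-form `Θ : X → (X →L Z)` stands for the family of its components; the
differential system it generates consists of these components and their exterior derivatives. -/

section EDS

variable {X Z : Type} [NormedAddCommGroup X] [NormedSpace ℝ X]
  [NormedAddCommGroup Z] [NormedSpace ℝ Z]

/-- The exterior derivative of a 1-form. -/
def extDerivOne (Θ : X → X →L[ℝ] Z) (p v w : X) : Z :=
  fderiv ℝ Θ p v w - fderiv ℝ Θ p w v

/-- The polar space `H(S)` of a tangent subspace `S` at `p`. -/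
def polarSpace (Θ : X → X →L[ℝ] Z) (p : X) (S : Submodule ℝ X) : Submodule ℝ X where
  carrier := {v | Θ p v = 0 ∧ ∀ w ∈ S, extDerivOne Θ p v w = 0}
  zero_mem' := by simp [extDerivOne]
  add_mem' := by
    rintro v v' ⟨h1, h2⟩ ⟨h1', h2'⟩
    refine ⟨by simp [h1, h1'], fun w hw => ?_⟩
    have := h2 w hw
    have := h2' w hw
    simp only [extDerivOne, map_add, add_apply] at *
    rw [add_sub_add_comm, h2 w hw, h2' w hw, add_zero]
  smul_mem' := by
    rintro c v ⟨h1, h2⟩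
    refine ⟨by simp [h1], fun w hw => ?_⟩
    have h := h2 w hw
    simp only [extDerivOne, map_smul, smul_apply] at *
    rw [← smul_sub, h, smul_zero]

/-- The vectors `e` form a basis of an integral element at `p`: all the 1-forms and all their
exterior derivatives vanish on the span of `e`. -/
def IsIntegralFrame (Θ : X → X →L[ℝ] Z) {k : ℕ} (p : X) (e : Fin k → X) : Prop :=
  LinearIndependent ℝ e ∧ (∀ i, Θ p (e i) = 0) ∧ ∀ i i', extDerivOne Θ p (e i) (e i') = 0

/-- The rank of the polar equations of the span of `e` at `p`: the codimension of the polar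
space. -/
def polarRank (Θ : X → X →L[ℝ] Z) {k : ℕ} (p : X) (e : Fin k → X) : ℕ :=
  Module.finrank ℝ (X ⧸ polarSpace Θ p (Submodule.span ℝ (Set.range e)))

/-- The integral element spanned by `e` at `p` is regular: the polar rank is constant on the
integral elements of the same dimension near it. -/
def IsRegularFrame (Θ : X → X →L[ℝ] Z) {k : ℕ} (p : X) (e : Fin k → X) : Prop :=
  IsIntegralFrame Θ p e ∧
    ∀ᶠ q : X × (Fin k → X) in 𝓝 (p, e),
      IsIntegralFrame Θ q.1 q.2 → polarRank Θ q.1 q.2 = polarRank Θ p e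

/-- The first `k` vectors of a frame. -/
def initialFrame {n : ℕ} (e : Fin n → X) (k : Fin (n + 1)) : Fin (k : ℕ) → X :=
  fun i => e (i.castLE (Nat.lt_succ_iff.mp k.2))

/-- `e` spans an ordinary integral element by way of the flag
`0 = E_0 ⊂ E_1 ⊂ ⋯ ⊂ E_n`, with `E_k` the span of the first `k` vectors: `E_0, …, E_{n-1}` are
regular. -/
def IsOrdinaryFlag (Θ : X → X →L[ℝ] Z) {n : ℕ} (p : X) (e : Fin n → X) : Prop :=
  IsIntegralFrame Θ p e ∧ ∀ k : Fin n, IsRegularFrame Θ p (initialFrame e k.castSucc)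

/-- The Cartan characters of a flag: `s_0` is the polar rank of `E_0`, and `s_k` is the polar rank
of `E_k` minus that of `E_{k-1}`. -/
def cartanCharacter (Θ : X → X →L[ℝ] Z) {n : ℕ} (p : X) (e : Fin n → X) : Fin (n + 1) → ℤ :=
  Fin.cases (polarRank Θ p (initialFrame e 0) : ℤ) fun k : Fin n =>
    (polarRank Θ p (initialFrame e k.succ) : ℤ) - polarRank Θ p (initialFrame e k.castSucc)

end EDS

section PDEasEDS

variable {n : ℕ} {F W : Type} [NormedAddCommGroup F] [NormedSpace ℝ F]
  [NormedAddCommGroup W] [NormedSpace ℝ W]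

/-- The contact form `du - P dx` on the first jet bundle. -/
def contactForm (j : J1 n F) : J1 n F →L[ℝ] F :=
  ContinuousLinearMap.fst ℝ F (Coord n →L[ℝ] F) ∘L
      ContinuousLinearMap.snd ℝ (Coord n) (F × (Coord n →L[ℝ] F)) -
    j.2.2 ∘L ContinuousLinearMap.fst ℝ (Coord n) (F × (Coord n →L[ℝ] F))

/-- The Pfaffian system of `Φ = 0` on the first jet bundle: `dΦ` and the contact form. -/
def pfaffForm (Φ : J1 n F → W) (j : J1 n F) : J1 n F →L[ℝ] W × F :=
  (fderiv ℝ Φ j).prod (contactForm j)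

/-- An ordinary flag of length `n` on which `dx¹ ∧ ⋯ ∧ dxⁿ` does not vanish. -/
def IsAdmissibleFlag (Φ : J1 n F → W) (j : J1 n F) (e : Fin n → J1 n F) : Prop :=
  IsOrdinaryFlag (pfaffForm Φ) j e ∧ LinearIndependent ℝ fun i => (e i).1

/-- The Pfaffian system of `Φ = 0` is in involution with respect to `x¹, …, xⁿ` over `U`: through
every point of the jet bundle over `U` there is an ordinary `n`-dimensional integral element on
which `dx¹ ∧ ⋯ ∧ dxⁿ` does not vanish. -/
def IsInInvolution (U : Set (Coord n)) (Φ : J1 n F → W) : Prop :=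
  ∀ j : J1 n F, j.1 ∈ U → ∃ e : Fin n → J1 n F, IsAdmissibleFlag Φ j e

/-- The Cartan characters `(s_0, …, s_n)` of the Pfaffian system of `Φ = 0` over `U`. -/
def HasCartanCharacters (U : Set (Coord n)) (Φ : J1 n F → W) (s : Fin (n + 1) → ℤ) : Prop :=
  ∀ j : J1 n F, j.1 ∈ U → ∀ e : Fin n → J1 n F, IsAdmissibleFlag Φ j e →
    ∀ k, cartanCharacter (pfaffForm Φ) j e k = s k

end PDEasEDS

/-! ### Metrics, curvature and the Riemann-Lanczos equations in local coordinates -/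

section Geometry

variable {n : ℕ}

/-- The partial derivative `∂_i f`. -/
def partialD (i : Fin n) (f : Coord n → ℝ) (x : Coord n) : ℝ :=
  fderiv ℝ f x (Pi.single i 1)

/-- `g` gives the components of a smooth metric, of any signature, on the open set `U`. -/
structure IsMetricOn (g : Coord n → Matrix (Fin n) (Fin n) ℝ) (U : Set (Coord n)) : Prop where
  isOpen : IsOpen U
  smooth : ∀ a b, ContDiffOn ℝ ∞ (fun x => g x a b) U
  symm : ∀ x ∈ U, (g x).IsSymm
  nondegenerate : ∀ x ∈ U, (g x).det ≠ 0

/-- The Christoffel symbols `Γ^a_{bc}`. -/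
def christoffel (g : Coord n → Matrix (Fin n) (Fin n) ℝ) (a b c : Fin n) (x : Coord n) : ℝ :=
  ∑ d, (g x)⁻¹ a d / 2 * (partialD b (fun y => g y d c) x + partialD c (fun y => g y d b) x
    - partialD d (fun y => g y b c) x)

/-- The curvature tensor
`R^a_{bcd} = ∂_c Γ^a_{bd} - ∂_d Γ^a_{bc} + Γ^a_{ce} Γ^e_{bd} - Γ^a_{de} Γ^e_{bc}`. -/
def riemannUp (g : Coord n → Matrix (Fin n) (Fin n) ℝ) (a b c d : Fin n) (x : Coord n) : ℝ :=
  partialD c (christoffel g a b d) x - partialD d (christoffel g a b c) x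
    + ∑ e, (christoffel g a c e x * christoffel g e b d x
      - christoffel g a d e x * christoffel g e b c x)

/-- The curvature tensor `R_{abcd}`. -/
def riemann (g : Coord n → Matrix (Fin n) (Fin n) ℝ) (a b c d : Fin n) (x : Coord n) : ℝ :=
  ∑ e, g x a e * riemannUp g e b c d x

/-- The Lanczos tensors at a point: `L_{abc} = L_{[ab]c}` and `L_{[abc]} = 0`; given the former,
the latter says that the cyclic sum vanishes. -/
def lanczosTensors (n : ℕ) : Submodule ℝ (Fin n → Fin n → Fin n → ℝ) where
  carrier := {L | (∀ a b c, L a b c = -L b a c) ∧ ∀ a b c, L a b c + L b c a + L c a b = 0}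
  zero_mem' := by simp
  add_mem' := by
    rintro L M ⟨h1, h2⟩ ⟨h1', h2'⟩
    refine ⟨fun a b c => ?_, fun a b c => ?_⟩
    · simp only [Pi.add_apply]; linarith [h1 a b c, h1' a b c]
    · simp only [Pi.add_apply]; linarith [h2 a b c, h2' a b c]
  smul_mem' := by
    rintro r L ⟨h1, h2⟩
    refine ⟨fun a b c => ?_, fun a b c => ?_⟩
    · simp only [Pi.smul_apply, smul_eq_mul]; rw [h1 a b c]; ring
    · simp only [Pi.smul_apply, smul_eq_mul]; rw [← mul_add, ← mul_add, h2 a b c, mul_zero]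

/-- `L_{abc;d}` as a function of the 1-jet of `L`, in which `∂_d L_{abc}` is
`j.2.2 (Pi.single d 1) a b c`. -/
def covDerivLanczos (g : Coord n → Matrix (Fin n) (Fin n) ℝ) (j : J1 n (lanczosTensors n))
    (a b c d : Fin n) : ℝ :=
  (j.2.2 (Pi.single d 1)).1 a b c
    - ∑ e, (christoffel g e a d j.1 * j.2.1.1 e b c + christoffel g e b d j.1 * j.2.1.1 a e c
      + christoffel g e c d j.1 * j.2.1.1 a b e)

/-- The Riemann-Lanczos system
`R_{abcd} - (L_{abc;d} - L_{abd;c} + L_{cda;b} - L_{cdb;a}) = 0`. -/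
def riemannLanczos (g : Coord n → Matrix (Fin n) (Fin n) ℝ) (j : J1 n (lanczosTensors n)) :
    Fin n → Fin n → Fin n → Fin n → ℝ :=
  fun a b c d => riemann g a b c d j.1 -
    (covDerivLanczos g j a b c d - covDerivLanczos g j a b d c
      + covDerivLanczos g j c d a b - covDerivLanczos g j c d b a)

/-- The differential gauge `L_{ab}{}^s{}_{;s} = g^{st} L_{abs;t}`. -/
def lanczosGauge (g : Coord n → Matrix (Fin n) (Fin n) ℝ) (j : J1 n (lanczosTensors n)) :
    Fin n → Fin n → ℝ :=
  fun a b => ∑ s, ∑ t, (g j.1)⁻¹ s t * covDerivLanczos g j a b s t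

/-- The Riemann-Lanczos system together with the differential gauge condition. -/
def riemannLanczosGauged (g : Coord n → Matrix (Fin n) (Fin n) ℝ)
    (j : J1 n (lanczosTensors n)) :
    (Fin n → Fin n → Fin n → Fin n → ℝ) × (Fin n → Fin n → ℝ) :=
  (riemannLanczos g j, lanczosGauge g j)

end Geometry

end

/-!
In the plane a Lanczos tensor has two components `L_{010}` and `L_{011}`, and since both sides of
the Riemann-Lanczos equations are antisymmetric in each of the two index pairs, these equations
reduce to a single one, `R_{0101} = 2 (L_{010;1} - L_{011;0})`, whose symbol is a curl. The
differential gauge adds one further equation, whose symbol is the divergence. The determinant of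
curl and divergence together, at a covector `ξ`, is a multiple of `g(ξ, ξ)`; hence for a metric of
either signature each of the two systems can be solved for derivatives in some direction
(`isNormalSystem_riemannLanczos`, `isNormalSystem_riemannLanczosGauged`).

Everything else holds for any such normal system (`IsNormalSystem`) of `p` linear equations for `m`
functions of two variables, and depends on `m` and `p` alone.

* Formal integrability (`IsNormalSystem.formallyIntegrable`). Let `u` solve the equations to order
  `r` at a point. By Taylor's formula (`exists_homPoly_flatTo`) the error of order `r + 1` is a
  homogeneous polynomial, and a correction of `u` by a homogeneous polynomial of degree `r + 2`
  enters it only through the symbol with coefficients frozen at the point. That operator is onto on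
  homogeneous polynomials (`exists_solution_homPoly`), by integration in the solved direction.
* Symbol. In a basis adapted to the solved direction all equations have class `2`, which is the
  largest value of the rank, so that `(α¹, α²) = (m, m - p)`. The `2 p` conditions on the `3 m`
  components of a symmetric form are independent, so that `dim M₂ = 3 m - 2 p = α¹ + 2 α²`
  (`IsNormalSystem.finrank_prolongedSymbol`).
* Pfaffian system. The polar rank is `m + p` at every point, `2 m + p` at integral lines whose
  annihilator is noncharacteristic, and `3 m` at integral planes transversal to the fibres. The
  noncharacteristic lines are open and dense among the integral lines that project isomorphically
  to the base, so that every regular line has their polar rank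
  (`IsNormalSystem.polarRank_of_isRegularFrame`). The characters are therefore
  `(m + p, m, m - p)` for every ordinary flag, also when some covectors are null.
-/


noncomputable section

/-! ### Functions that are flat to a given order at a point -/

section Flat

variable {E V W Z : Type} [NormedAddCommGroup E] [NormedSpace ℝ E] [NormedAddCommGroup V]
  [NormedSpace ℝ V] [NormedAddCommGroup W] [NormedSpace ℝ W] [NormedAddCommGroup Z]
  [NormedSpace ℝ Z]

/-- `h` is flat to order `n` at `x`: all its derivatives of order less than `n` vanish there. For
smooth `h` this says `h = O(|y - x| ^ n)`. -/
def FlatTo (n : ℕ) (h : E → W) (x : E) : Prop :=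
  ∀ i < n, iteratedFDeriv ℝ i h x = 0

theorem flatTo_zero (h : E → W) (x : E) : FlatTo 0 h x := fun _ hi => absurd hi (Nat.not_lt_zero _)

theorem FlatTo.mono {m n : ℕ} {h : E → W} {x : E} (hh : FlatTo n h x) (hmn : m ≤ n) :
    FlatTo m h x := fun i hi => hh i (hi.trans_le hmn)

theorem FlatTo.congr {n : ℕ} {h h' : E → W} {x : E} (hh : FlatTo n h x) (he : h =ᶠ[𝓝 x] h') :
    FlatTo n h' x := fun i hi => by
  rw [← (he.iteratedFDeriv ℝ i).eq_of_nhds]; exact hh i hi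

theorem FlatTo.add {n : ℕ} {f h : E → W} {x : E} (hf : FlatTo n f x) (hh : FlatTo n h x)
    (cf : ContDiffAt ℝ ∞ f x) (ch : ContDiffAt ℝ ∞ h x) : FlatTo n (fun y => f y + h y) x :=
  fun i hi => by
  have := iteratedFDeriv_add_apply (i := i) (cf.of_le (by exact_mod_cast le_top))
    (ch.of_le (by exact_mod_cast le_top))
  rw [show (fun y => f y + h y) = f + h from rfl, this, hf i hi, hh i hi, add_zero]

theorem flatTo_succ_iff {n : ℕ} {h : E → W} {x : E} :
    FlatTo (n + 1) h x ↔ h x = 0 ∧ FlatTo n (fderiv ℝ h) x := by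
  constructor
  · intro H
    refine ⟨?_, fun i hi => ?_⟩
    · have := congrArg (fun M => M 0) (H 0 (Nat.succ_pos n))
      simpa using this
    · rw [← norm_eq_zero, norm_iteratedFDeriv_fderiv, H (i + 1) (by omega), norm_zero]
  · rintro ⟨h0, H⟩ i hi
    cases i with
    | zero => ext m; simpa using h0
    | succ i => rw [← norm_eq_zero, ← norm_iteratedFDeriv_fderiv, H i (by omega), norm_zero]

theorem flatTo_one_iff {h : E → W} {x : E} : FlatTo 1 h x ↔ h x = 0 := by
  rw [flatTo_succ_iff]; simp [flatTo_zero]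

theorem flatTo_clm_comp_iff {n : ℕ} {h : E → W} {x : E} (L : W →L[ℝ] Z)
    (hL : Function.Injective L) (ch : ContDiffAt ℝ ∞ h x) :
    FlatTo n (fun y => L (h y)) x ↔ FlatTo n h x := by
  refine forall₂_congr fun i _ => ?_
  have := L.iteratedFDeriv_comp_left (i := i) ch (by exact_mod_cast le_top)
  rw [show (fun y => L (h y)) = L ∘ h from rfl, this]
  constructor
  · intro H
    ext m
    apply hL
    simpa using congrArg (fun M => M m) H
  · intro H
    rw [H]; ext m; simp

/-- Orders of flatness add up under a bilinear product, by the Leibniz rule. -/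
theorem FlatTo.bilin {m n : ℕ} {f : E → V} {h : E → W} {x : E} (B : V →L[ℝ] W →L[ℝ] Z)
    (hf : FlatTo m f x) (hh : FlatTo n h x)
    (cf : ContDiffAt ℝ ∞ f x) (ch : ContDiffAt ℝ ∞ h x) :
    FlatTo (m + n) (fun y => B (f y) (h y)) x := by
  intro i hi
  have hle : ((i : ℕ∞) : WithTop ℕ∞) ≤ ∞ := by exact_mod_cast le_top
  obtain ⟨s, hs, cfs⟩ := (cf.of_le hle).contDiffOn (m := i) le_rfl (by simp)
  obtain ⟨t, ht, cht⟩ := (ch.of_le hle).contDiffOn (m := i) le_rfl (by simp)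
  obtain ⟨u, hu, uo, xu⟩ := mem_nhds_iff.1 (Filter.inter_mem hs ht)
  have key := B.norm_iteratedFDerivWithin_le_of_bilinear (n := i)
    (cfs.mono fun y hy => by simpa using (hu hy).1)
    (cht.mono fun y hy => by simpa using (hu hy).2) uo.uniqueDiffOn xu le_rfl
  rw [iteratedFDerivWithin_of_isOpen i uo xu] at key
  rw [← norm_le_zero_iff]
  refine key.trans (le_of_eq ?_)
  rw [Finset.sum_eq_zero, mul_zero]
  intro k hk
  rw [iteratedFDerivWithin_of_isOpen _ uo xu, iteratedFDerivWithin_of_isOpen _ uo xu]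
  rcases lt_or_ge k m with h1 | h1
  · rw [hf k h1]; simp
  · have hk' := Finset.mem_range.1 hk
    rw [hh (i - k) (by omega)]; simp

end Flat

/-! ### Homogeneous polynomials in two variables -/

section HomPoly

variable {W Z : Type} [NormedAddCommGroup W] [NormedSpace ℝ W] [NormedAddCommGroup Z]
  [NormedSpace ℝ Z]

/-- The monomial `η(y - x) ^ i ξ(y - x) ^ j c`. -/
def monom (η ξ : Coord 2 →L[ℝ] ℝ) (x : Coord 2) (i j : ℕ) (c : W) (y : Coord 2) : W :=
  (η (y - x) ^ i * ξ (y - x) ^ j) • c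

/-- The homogeneous polynomials of degree `n` in the linear coordinates `η`, `ξ` about `x`. -/
def homPoly (W : Type) [NormedAddCommGroup W] [NormedSpace ℝ W] (η ξ : Coord 2 →L[ℝ] ℝ)
    (x : Coord 2) (n : ℕ) : Submodule ℝ (Coord 2 → W) :=
  Submodule.span ℝ {q | ∃ i j c, i + j = n ∧ q = monom η ξ x i j c}

variable {η ξ : Coord 2 →L[ℝ] ℝ} {x : Coord 2} {n : ℕ}

theorem contDiff_monom (i j : ℕ) (c : W) : ContDiff ℝ ∞ (monom η ξ x i j c) := by
  unfold monom; fun_prop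

theorem contDiff_of_mem_homPoly {q : Coord 2 → W} (hq : q ∈ homPoly W η ξ x n) :
    ContDiff ℝ ∞ q := by
  induction hq using Submodule.span_induction with
  | mem q hq => obtain ⟨i, j, c, -, rfl⟩ := hq; exact contDiff_monom i j c
  | zero => exact contDiff_const
  | add p q _ _ hp hq => exact hp.add hq
  | smul r q _ hq => exact contDiff_const.smul hq

theorem hasFDerivAt_monom (i j : ℕ) (c : W) (y : Coord 2) :
    HasFDerivAt (monom η ξ x i j c)
      ((((i : ℝ) * η (y - x) ^ (i - 1) * ξ (y - x) ^ j) • η +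
        ((j : ℝ) * η (y - x) ^ i * ξ (y - x) ^ (j - 1)) • ξ).smulRight c) y := by
  have h1 : HasFDerivAt (fun y => η (y - x)) η y :=
    η.hasFDerivAt.comp y ((hasFDerivAt_id y).sub_const x)
  have h2 : HasFDerivAt (fun y => ξ (y - x)) ξ y :=
    ξ.hasFDerivAt.comp y ((hasFDerivAt_id y).sub_const x)
  have := ((h1.pow i).mul (h2.pow j)).smul_const c
  refine this.congr_fderiv ?_
  ext v
  simp
  congr 1
  ring

/-- Euler's identity for homogeneous polynomials. -/
theorem fderiv_apply_sub_of_mem_homPoly {q : Coord 2 → W} (hq : q ∈ homPoly W η ξ x n)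
    (y : Coord 2) : fderiv ℝ q y (y - x) = (n : ℝ) • q y := by
  induction hq using Submodule.span_induction with
  | mem q hq =>
    obtain ⟨i, j, c, rfl, rfl⟩ := hq
    rw [(hasFDerivAt_monom i j c y).fderiv]
    simp only [ContinuousLinearMap.smulRight_apply, add_apply,
      smul_apply, smul_eq_mul, monom, smul_smul]
    congr 1
    rcases i with _ | i <;> rcases j with _ | j <;> simp <;> ring
  | zero => simp
  | add p q hp' hq' hp hq =>
    rw [fderiv_add ((contDiff_of_mem_homPoly hp').differentiable (by simp) y)
      ((contDiff_of_mem_homPoly hq').differentiable (by simp) y)]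
    simp [hp, hq]
  | smul r q hq' hq =>
    rw [fderiv_const_smul ((contDiff_of_mem_homPoly hq').differentiable (by simp) y), smul_apply,
      hq, Pi.smul_apply, smul_comm]

theorem flatTo_pow_clm (η : Coord 2 →L[ℝ] ℝ) (x : Coord 2) (i : ℕ) :
    FlatTo i (fun y => η (y - x) ^ i) x := by
  induction i with
  | zero => exact flatTo_zero _ _
  | succ i ih =>
    have h1 : FlatTo 1 (fun y => η (y - x)) x := flatTo_one_iff.2 (by simp)
    have := ih.bilin (ContinuousLinearMap.mul ℝ ℝ) h1 (by fun_prop) (by fun_prop)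
    simpa [pow_succ] using this

theorem flatTo_of_mem_homPoly {q : Coord 2 → W} (hq : q ∈ homPoly W η ξ x n) : FlatTo n q x := by
  induction hq using Submodule.span_induction with
  | mem q hq =>
    obtain ⟨i, j, c, rfl, rfl⟩ := hq
    have h1 := (flatTo_pow_clm η x i).bilin (ContinuousLinearMap.mul ℝ ℝ) (flatTo_pow_clm ξ x j)
      (by fun_prop) (by fun_prop)
    exact h1.bilin (ContinuousLinearMap.lsmul ℝ ℝ) (flatTo_zero (fun _ => c) x)
      (by simp only [ContinuousLinearMap.mul_apply']; fun_prop) contDiffAt_const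
  | zero => intro i _; exact congrFun iteratedFDeriv_fun_zero x
  | add p q hp' hq' hp hq =>
    exact hp.add hq (contDiff_of_mem_homPoly hp').contDiffAt
      (contDiff_of_mem_homPoly hq').contDiffAt
  | smul r q hq' hq =>
    have := (flatTo_zero (fun _ => r) x).bilin (ContinuousLinearMap.lsmul ℝ ℝ) hq
      contDiffAt_const (contDiff_of_mem_homPoly hq').contDiffAt
    rw [zero_add] at this
    exact this

theorem apply_sub_mem_homPoly {e f : Coord 2} (hdec : ∀ v, v = η v • e + ξ v • f)
    {Q : Coord 2 → Coord 2 →L[ℝ] W} (hQ : Q ∈ homPoly (Coord 2 →L[ℝ] W) η ξ x n) :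
    (fun y => Q y (y - x)) ∈ homPoly W η ξ x (n + 1) := by
  induction hQ using Submodule.span_induction with
  | mem q hq =>
    obtain ⟨i, j, C, rfl, rfl⟩ := hq
    have : (fun y => monom η ξ x i j C y (y - x)) =
        monom η ξ x (i + 1) j (C e) + monom η ξ x i (j + 1) (C f) := by
      funext y
      have hC : C (y - x) = η (y - x) • C e + ξ (y - x) • C f := by
        rw [← map_smul, ← map_smul, ← map_add, ← hdec]
      simp only [monom, smul_apply, Pi.add_apply, hC, smul_add, smul_smul]
      congr 2 <;> ring
    rw [this]
    exact add_mem (Submodule.subset_span ⟨_, _, _, by omega, rfl⟩)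
      (Submodule.subset_span ⟨_, _, _, by omega, rfl⟩)
  | zero => exact zero_mem _
  | add p q _ _ hp hq => exact add_mem hp hq
  | smul r q _ hq => exact Submodule.smul_mem _ r hq

/-- A smooth function that is flat to order `n` agrees with a homogeneous polynomial of degree `n`
up to functions that are flat to order `n + 1`. The polynomial is found by applying the induction
hypothesis to the derivative and integrating along rays. -/
theorem exists_homPoly_flatTo {e f : Coord 2} (hdec : ∀ v, v = η v • e + ξ v • f) {h : Coord 2 → W}
    (ch : ContDiffAt ℝ ∞ h x) (hh : FlatTo n h x) :
    ∃ q ∈ homPoly W η ξ x n, FlatTo (n + 1) (fun y => h y + q y) x := by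
  induction n generalizing W with
  | zero =>
    refine ⟨monom η ξ x 0 0 (-h x), Submodule.subset_span ⟨0, 0, _, rfl, rfl⟩, ?_⟩
    rw [flatTo_one_iff]
    simp [monom]
  | succ n ih =>
    have ch' : ContDiffAt ℝ ∞ (fderiv ℝ h) x := ch.fderiv_right (by simp)
    obtain ⟨Q, hQ, hfl⟩ := ih ch' (flatTo_succ_iff.1 hh).2
    have cQ := contDiff_of_mem_homPoly hQ
    have cs : ContDiffAt ℝ ∞ (fun y => y - x) x := by fun_prop
    set N : ℝ := (n : ℝ) + 1 with hN
    have hN0 : N ≠ 0 := by positivity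
    refine ⟨N⁻¹ • fun y => Q y (y - x), Submodule.smul_mem _ _ (apply_sub_mem_homPoly hdec hQ), ?_⟩
    rw [flatTo_succ_iff]
    refine ⟨by simp [(flatTo_succ_iff.1 hh).1], ?_⟩
    -- The curl of `Q` is that of `fderiv h + Q`, since second derivatives of `h` are symmetric.
    set G : Coord 2 → Coord 2 →L[ℝ] W := fun z => fderiv ℝ h z + Q z with hG
    have cG : ContDiffAt ℝ ∞ G x := ch'.add cQ.contDiffAt
    have cG' : ContDiffAt ℝ ∞ (fderiv ℝ G) x := cG.fderiv_right (by simp)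
    obtain ⟨B, hB⟩ : ∃ B : (Coord 2 →L[ℝ] Coord 2 →L[ℝ] W) →L[ℝ] Coord 2 →L[ℝ] Coord 2 →L[ℝ] W,
        ∀ M v w, B M v w = M w v - M v w :=
      ⟨(ContinuousLinearMap.flipₗᵢ ℝ (Coord 2) (Coord 2)
        W).toContinuousLinearEquiv.toContinuousLinearMap - ContinuousLinearMap.id ℝ _,
        fun M v w => rfl⟩
    have hcurl : FlatTo (n + 1) (fun y => N⁻¹ • B (fderiv ℝ G y) (y - x)) x := by
      have h1 : FlatTo 1 (fun y => y - x) x := flatTo_one_iff.2 (sub_self x)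
      exact (flatTo_succ_iff.1 hfl).2.bilin (N⁻¹ • B) h1 cG' cs
    refine (hfl.add hcurl cG ?_).congr ?_
    · exact ((contDiffAt_const (c := N⁻¹)).smul ((B.contDiff.contDiffAt.comp x cG').clm_apply cs) :)
    · have hsymm : ∀ᶠ y in 𝓝 x, ContDiffAt ℝ 2 h y :=
        (contDiffAt_infty.1 ch 2).eventually (by simp)
      filter_upwards [hsymm] with y hy
      have hs : IsSymmSndFDerivAt ℝ h y := hy.isSymmSndFDerivAt (by simp)
      have dQ : DifferentiableAt ℝ Q y := cQ.differentiable (by simp) y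
      have dh : DifferentiableAt ℝ h y := hy.differentiableAt (by simp)
      have dh' : DifferentiableAt ℝ (fderiv ℝ h) y :=
        (hy.fderiv_right (m := 1) (by norm_num)).differentiableAt (by simp)
      have ds : HasFDerivAt (fun y => y - x) (ContinuousLinearMap.id ℝ (Coord 2)) y :=
        (hasFDerivAt_id y).sub_const x
      have hq := (dQ.hasFDerivAt.clm_apply ds).const_smul N⁻¹
      have heul := fderiv_apply_sub_of_mem_homPoly hQ y
      refine Eq.trans ?_ (dh.hasFDerivAt.add hq).fderiv.symm
      have hGy : fderiv ℝ G y = fderiv ℝ (fderiv ℝ h) y + fderiv ℝ Q y := fderiv_add dh' dQ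
      ext1 v
      have heul' : fderiv ℝ Q y (y - x) v = (n : ℝ) • Q y v := by rw [heul]; rfl
      have hn : (n : ℝ) = N - 1 := by rw [hN]; ring
      have h1 : fderiv ℝ G y v (y - x) =
          fderiv ℝ (fderiv ℝ h) y v (y - x) + fderiv ℝ Q y v (y - x) := by
        rw [hGy]; rfl
      have h2 : fderiv ℝ G y (y - x) v =
          fderiv ℝ (fderiv ℝ h) y v (y - x) + (N - 1) • Q y v := by
        rw [hGy, ← hn, ← heul', hs.eq v (y - x)]; rfl
      change fderiv ℝ h y v + Q y v + N⁻¹ • B (fderiv ℝ G y) (y - x) v =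
        fderiv ℝ h y v + N⁻¹ • (Q y v + fderiv ℝ Q y v (y - x))
      rw [hB, h1, h2]
      match_scalars <;> field_simp <;> ring

/-- A differential operator `D ↦ S (D ·)` with constant coefficients whose symbol is onto at the
covector `ξ`, with right inverse `s`, can be solved for homogeneous polynomials: integrate in the
direction of `ξ`, which trades powers of `η` in the error for powers of `ξ`. -/
theorem exists_solution_monom (S : (Coord 2 →L[ℝ] Z) →L[ℝ] W) (s : W →L[ℝ] Z)
    (hs : ∀ c, S (ξ.smulRight (s c)) = c) (i j : ℕ) (c : W) :
    ∃ w ∈ homPoly Z η ξ x (i + j + 1), ∀ y, S (fderiv ℝ w y) = monom η ξ x i j c y := by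
  induction i generalizing j c with
  | zero =>
    refine ⟨monom η ξ x 0 (j + 1) (((j : ℝ) + 1)⁻¹ • s c),
      Submodule.subset_span ⟨_, _, _, by omega, rfl⟩, fun y => ?_⟩
    rw [(hasFDerivAt_monom _ _ _ y).fderiv]
    have hj : (j : ℝ) + 1 ≠ 0 := by positivity
    have : ((((0 : ℕ) : ℝ) * η (y - x) ^ (0 - 1) * ξ (y - x) ^ (j + 1)) • η +
        (((j + 1 : ℕ) : ℝ) * η (y - x) ^ 0 * ξ (y - x) ^ (j + 1 - 1)) • ξ).smulRight
        (((j : ℝ) + 1)⁻¹ • s c) = ξ (y - x) ^ j • ξ.smulRight (s c) := by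
      ext1 v
      simp
      match_scalars
      field_simp
    rw [this, map_smul, hs]
    simp [monom]
  | succ i ih =>
    obtain ⟨w, hw, hw'⟩ := ih (j + 1) (S (η.smulRight (s c)))
    have hj : (j : ℝ) + 1 ≠ 0 := by positivity
    have hw1 : monom η ξ x (i + 1) (j + 1) (((j : ℝ) + 1)⁻¹ • s c) ∈
        homPoly Z η ξ x (i + 1 + j + 1) := Submodule.subset_span ⟨_, _, _, by omega, rfl⟩
    refine ⟨monom η ξ x (i + 1) (j + 1) (((j : ℝ) + 1)⁻¹ • s c) +
      (-(((i : ℝ) + 1) / ((j : ℝ) + 1))) • w, add_mem hw1 (Submodule.smul_mem _ _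
        (by convert hw using 2; omega)), fun y => ?_⟩
    have dw := (contDiff_of_mem_homPoly hw).differentiable (by simp) y
    rw [((hasFDerivAt_monom _ _ _ y).add (dw.hasFDerivAt.const_smul _)).fderiv, map_add, map_smul,
      hw']
    have : ((((i + 1 : ℕ) : ℝ) * η (y - x) ^ (i + 1 - 1) * ξ (y - x) ^ (j + 1)) • η +
        (((j + 1 : ℕ) : ℝ) * η (y - x) ^ (i + 1) * ξ (y - x) ^ (j + 1 - 1)) • ξ).smulRight
        (((j : ℝ) + 1)⁻¹ • s c) =
        ((((i : ℝ) + 1) / ((j : ℝ) + 1)) * (η (y - x) ^ i * ξ (y - x) ^ (j + 1))) •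
          η.smulRight (s c) + (η (y - x) ^ (i + 1) * ξ (y - x) ^ j) • ξ.smulRight (s c) := by
      ext1 v
      simp
      match_scalars
      field_simp
    rw [this, map_add, map_smul, map_smul, hs]
    simp only [monom]
    module

theorem exists_solution_homPoly (S : (Coord 2 →L[ℝ] Z) →L[ℝ] W) (s : W →L[ℝ] Z)
    (hs : ∀ c, S (ξ.smulRight (s c)) = c) {q : Coord 2 → W} (hq : q ∈ homPoly W η ξ x n) :
    ∃ w ∈ homPoly Z η ξ x (n + 1), ∀ y, S (fderiv ℝ w y) = q y := by
  induction hq using Submodule.span_induction with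
  | mem q hq =>
    obtain ⟨i, j, c, rfl, rfl⟩ := hq
    exact exists_solution_monom S s hs i j c
  | zero => exact ⟨0, zero_mem _, fun y => by simp⟩
  | add p q _ _ hp hq =>
    obtain ⟨v, hv, hv'⟩ := hp
    obtain ⟨w, hw, hw'⟩ := hq
    refine ⟨v + w, add_mem hv hw, fun y => ?_⟩
    rw [fderiv_add ((contDiff_of_mem_homPoly hv).differentiable (by simp) y)
      ((contDiff_of_mem_homPoly hw).differentiable (by simp) y), map_add, hv', hw']
    rfl
  | smul r q _ hq =>
    obtain ⟨w, hw, hw'⟩ := hq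
    refine ⟨r • w, Submodule.smul_mem _ _ hw, fun y => ?_⟩
    rw [fderiv_const_smul ((contDiff_of_mem_homPoly hw).differentiable (by simp) y), map_smul, hw']
    rfl

end HomPoly

/-! ### Covectors in the plane -/

/-- The covector `y ∧ ·`. Every covector of the plane has this form, with `y` in its kernel. -/
def perp : Coord 2 →L[ℝ] Coord 2 →L[ℝ] ℝ :=
  let π (i : Fin 2) : Coord 2 →L[ℝ] ℝ := ContinuousLinearMap.proj i
  (π 0).smulRight (π 1) - (π 1).smulRight (π 0)

theorem perp_apply (y v : Coord 2) : perp y v = y 0 * v 1 - y 1 * v 0 := by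
  simp [perp]

theorem perp_self (y : Coord 2) : perp y y = 0 := by rw [perp_apply]; ring

/-- A vector `y ≠ 0` is completed to a frame `y`, `z` with dual frame `η`, `perp y`. -/
theorem exists_dual_frame {y : Coord 2} (hy : y ≠ 0) : ∃ (z : Coord 2) (η : Coord 2 →L[ℝ] ℝ),
    perp y z = 1 ∧ η y = 1 ∧ η z = 0 ∧ ∀ v, v = η v • y + perp y v • z := by
  have hN : y 0 ^ 2 + y 1 ^ 2 ≠ 0 := by
    intro h
    apply hy
    ext i
    fin_cases i
    · simp only [Fin.zero_eta, Pi.zero_apply]; nlinarith [sq_nonneg (y 0), sq_nonneg (y 1)]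
    · simp only [Fin.mk_one, Pi.zero_apply]; nlinarith [sq_nonneg (y 0), sq_nonneg (y 1)]
  set N := y 0 ^ 2 + y 1 ^ 2 with hNdef
  refine ⟨![-y 1 / N, y 0 / N], -perp ![-y 1 / N, y 0 / N], ?_, ?_, ?_, fun v => ?_⟩
  · rw [perp_apply]; simp; field_simp; rw [hNdef]; ring
  · rw [neg_apply, perp_apply]; simp; field_simp; rw [hNdef]; ring
  · rw [neg_apply, perp_self, neg_zero]
  · ext i
    fin_cases i <;> simp [perp_apply] <;> field_simp <;> rw [hNdef] <;> ring

theorem exists_basis_zero_eq {y : Coord 2} (hy : y ≠ 0) :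
    ∃ b : Module.Basis (Fin 2) ℝ (Coord 2), b 0 = y := by
  obtain ⟨z, η, h1, h2, h3, -⟩ := exists_dual_frame hy
  have hli : LinearIndependent ℝ ![y, z] := by
    rw [LinearIndependent.pair_iff]
    intro s t h
    have ha := congrArg η h
    have hb := congrArg (perp y) h
    simp [h1, h2, h3, perp_self] at ha hb
    exact ⟨ha, hb⟩
  exact ⟨basisOfLinearIndependentOfCardEqFinrank hli (by simp), by simp⟩

/-! ### Normal systems in the plane -/

section Normal

variable {F W W₀ : Type} [NormedAddCommGroup F] [NormedSpace ℝ F]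
  [NormedAddCommGroup W] [NormedSpace ℝ W] [NormedAddCommGroup W₀] [NormedSpace ℝ W₀]

/-- The system `Φ = 0` in the plane is linear, consists of the independent equations
`f x + a x (u x) + σ x (Du x) = 0` up to the injection `ι` of their values into those of `Φ`,
and can be solved for derivatives in one direction: at every point the symbol is onto on the
multiples of a suitable covector `perp y`. -/
structure IsNormalSystem (U : Set (Coord 2)) (Φ : J1 2 F → W) (ι : W₀ →L[ℝ] W)
    (f : Coord 2 → W₀) (a : Coord 2 → F →L[ℝ] W₀) (σ : Coord 2 → (Coord 2 →L[ℝ] F) →L[ℝ] W₀) :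
    Prop where
  isOpen : IsOpen U
  injective : Function.Injective ι
  eq : ∀ j : J1 2 F, j.1 ∈ U → Φ j = ι (f j.1 + a j.1 j.2.1 + σ j.1 j.2.2)
  contDiffOn_f : ContDiffOn ℝ ∞ f U
  contDiffOn_a : ContDiffOn ℝ ∞ a U
  contDiffOn_σ : ContDiffOn ℝ ∞ σ U
  normal : ∀ x ∈ U, ∃ y, y ≠ 0 ∧ Function.Surjective fun v : F => σ x ((perp y).smulRight v)

variable {U : Set (Coord 2)} {Φ : J1 2 F → W} {ι : W₀ →L[ℝ] W} {f : Coord 2 → W₀}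
  {a : Coord 2 → F →L[ℝ] W₀} {σ : Coord 2 → (Coord 2 →L[ℝ] F) →L[ℝ] W₀}

theorem exists_rightInverse_symbol [FiniteDimensional ℝ W₀] {S : (Coord 2 →L[ℝ] F) →L[ℝ] W₀}
    {ξ : Coord 2 →L[ℝ] ℝ} (hS : Function.Surjective fun v : F => S (ξ.smulRight v)) :
    ∃ s : W₀ →L[ℝ] F, ∀ c, S (ξ.smulRight (s c)) = c := by
  let T : F →ₗ[ℝ] W₀ :=
    { toFun := fun v => S (ξ.smulRight v)
      map_add' := fun v w => by
        rw [← map_add]; congr 1; ext1; simp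
      map_smul' := fun r v => by
        rw [RingHom.id_apply, ← map_smul]; congr 1; ext1 w; exact smul_comm (ξ w) r v }
  obtain ⟨s, hs⟩ := T.exists_rightInverse_of_surjective (LinearMap.range_eq_top.2 hS)
  exact ⟨LinearMap.toContinuousLinearMap s, fun c => congrArg (fun g => g c) hs⟩

namespace IsNormalSystem

theorem contDiffAt_eval (H : IsNormalSystem U Φ ι f a σ) {x : Coord 2} (hx : x ∈ U)
    {u : Coord 2 → F} (hu : ContDiff ℝ ∞ u) :
    ContDiffAt ℝ ∞ (fun y => f y + a y (u y) + σ y (fderiv ℝ u y)) x := by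
  have hU := H.isOpen.mem_nhds hx
  have hu' : ContDiff ℝ ∞ (fderiv ℝ u) := hu.fderiv_right (by simp)
  exact ((H.contDiffOn_f.contDiffAt hU).add
    ((H.contDiffOn_a.contDiffAt hU).clm_apply hu.contDiffAt)).add
    ((H.contDiffOn_σ.contDiffAt hU).clm_apply hu'.contDiffAt)

/-- The equations and their derivatives of order at most `r` hold at a point when the independent
equations are flat to order `r + 1` there. -/
theorem mem_prolongedSystem_iff (H : IsNormalSystem U Φ ι f a σ) {r : ℕ}
    {j : Coord 2 × JetFibre 2 F (r + 1)} :
    j ∈ prolongedSystem U Φ r ↔ j.1 ∈ U ∧ ∃ u : Coord 2 → F, ContDiff ℝ ∞ u ∧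
      j.2 = jetAt (r + 1) u j.1 ∧
      FlatTo (r + 1) (fun y => f y + a y (u y) + σ y (fderiv ℝ u y)) j.1 := by
  refine and_congr_right fun hx => exists_congr fun u => and_congr_right fun hu =>
    and_congr_right fun _ => ?_
  rw [← flatTo_clm_comp_iff ι H.injective (H.contDiffAt_eval hx hu)]
  have he : (fun y => ι (f y + a y (u y) + σ y (fderiv ℝ u y))) =ᶠ[𝓝 j.1] evalSystem Φ u := by
    filter_upwards [H.isOpen.mem_nhds hx] with y hy
    exact (H.eq (y, u y, fderiv ℝ u y) hy).symm
  constructor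
  · exact fun h => FlatTo.congr (fun i hi => h i (by omega)) he.symm
  · exact fun h i hi => (h.congr he) i (by omega)

/-- Formal power series solutions can be continued order by order: the obstruction of order
`r + 1` is a homogeneous polynomial, which the symbol with coefficients frozen at the point
attains. -/
theorem formallyIntegrable [FiniteDimensional ℝ W₀] (H : IsNormalSystem U Φ ι f a σ) :
    FormallyIntegrable U Φ := by
  intro r
  ext ⟨x, J⟩
  constructor
  · rintro ⟨j', hj', he⟩
    rw [H.mem_prolongedSystem_iff] at hj'
    obtain ⟨hx, u, hu, hJ, hfl⟩ := hj'
    rw [← he, H.mem_prolongedSystem_iff]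
    exact ⟨hx, u, hu, funext fun i => congrFun hJ i.castSucc, hfl.mono (by simp)⟩
  · intro hj
    rw [H.mem_prolongedSystem_iff] at hj
    obtain ⟨hx, u, hu, hJ, hfl⟩ := hj
    change x ∈ U at hx
    obtain ⟨y, hy, hsurj⟩ := H.normal x hx
    obtain ⟨z, η, -, -, -, hdec⟩ := exists_dual_frame hy
    obtain ⟨s, hs⟩ := exists_rightInverse_symbol hsurj
    obtain ⟨q, hq, hqfl⟩ := exists_homPoly_flatTo hdec (H.contDiffAt_eval hx hu) hfl
    obtain ⟨w, hw, hwq⟩ := exists_solution_homPoly (σ x) s hs hq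
    have cw := contDiff_of_mem_homPoly hw
    have cw' : ContDiff ℝ ∞ (fderiv ℝ w) := cw.fderiv_right (by simp)
    have fw : FlatTo (r + 1 + 1) w x := flatTo_of_mem_homPoly hw
    have hU := H.isOpen.mem_nhds hx
    have ca := H.contDiffOn_a.contDiffAt hU
    have cσ := H.contDiffOn_σ.contDiffAt hU
    refine ⟨(x, jetAt (r + 1 + 1) (fun y => u y + w y) x), ?_, ?_⟩
    · rw [H.mem_prolongedSystem_iff]
      refine ⟨hx, _, hu.add cw, rfl, ?_⟩
      have f1 : FlatTo (r + 1 + 1) (fun y => a y (w y)) x := by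
        simpa using (flatTo_zero a x).bilin (ContinuousLinearMap.id ℝ _) fw ca cw.contDiffAt
      have c1 : ContDiffAt ℝ ∞ (fun y => σ y - σ x) x := cσ.sub contDiffAt_const
      have f2 : FlatTo (r + 1 + 1) (fun y => (σ y - σ x) (fderiv ℝ w y)) x := by
        have h1 : FlatTo 1 (fun y => σ y - σ x) x := flatTo_one_iff.2 (sub_self (σ x))
        have := h1.bilin (ContinuousLinearMap.id ℝ _) (flatTo_succ_iff.1 fw).2 c1 cw'.contDiffAt
        rwa [add_comm 1] at this
      have c2 := ca.clm_apply cw.contDiffAt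
      have c3 := c1.clm_apply cw'.contDiffAt
      refine ((hqfl.add f1 ((H.contDiffAt_eval hx hu).add (contDiff_of_mem_homPoly hq).contDiffAt)
        c2).add f2 (((H.contDiffAt_eval hx hu).add
          (contDiff_of_mem_homPoly hq).contDiffAt).add c2) c3).congr
        (Filter.Eventually.of_forall fun y => ?_)
      have hd : fderiv ℝ (fun y => u y + w y) y = fderiv ℝ u y + fderiv ℝ w y :=
        fderiv_add (hu.differentiable (by simp) y) (cw.differentiable (by simp) y)
      simp only [hd, map_add, sub_apply, hwq]
      abel
    · refine Prod.ext rfl (funext fun i => ?_)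
      rw [hJ]
      change iteratedFDeriv ℝ (i : ℕ) (fun y => u y + w y) x = iteratedFDeriv ℝ (i : ℕ) u x
      have := iteratedFDeriv_add_apply (i := (i : ℕ)) (x := x)
        (hu.contDiffAt.of_le (by exact_mod_cast le_top))
        (cw.contDiffAt.of_le (by exact_mod_cast le_top))
      rw [show (fun y => u y + w y) = u + w from rfl, this, fw i i.2, add_zero]

/-! ### The symbol of a normal system -/

theorem symbolMap_eq (H : IsNormalSystem U Φ ι f a σ) {j : J1 2 F} (hj : j.1 ∈ U) :
    symbolMap Φ j = ι ∘L σ j.1 := by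
  have : (fun P : Coord 2 →L[ℝ] F => Φ (j.1, j.2.1, P)) =
      fun P => ι (f j.1 + a j.1 j.2.1) + (ι ∘L σ j.1) P := by
    funext P
    rw [H.eq (j.1, j.2.1, P) hj, map_add]; rfl
  rw [symbolMap, this, fderiv_const_add, ContinuousLinearMap.fderiv]

theorem surjective_σ (H : IsNormalSystem U Φ ι f a σ) {x : Coord 2} (hx : x ∈ U) :
    Function.Surjective (σ x) := by
  obtain ⟨y, -, hs⟩ := H.normal x hx
  exact fun c => (hs c).imp' _ fun _ h => h

theorem rankOfClassGT_eq (H : IsNormalSystem U Φ ι f a σ) {j : J1 2 F} (hj : j.1 ∈ U)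
    (b : Module.Basis (Fin 2) ℝ (Coord 2)) (k : ℕ) :
    rankOfClassGT Φ j b k =
      Module.finrank ℝ ((derivsOfClassGT F b k).map (σ j.1).toLinearMap) := by
  rw [rankOfClassGT, H.symbolMap_eq hj]
  rw [show (ι ∘L σ j.1).toLinearMap = ι.toLinearMap ∘ₗ (σ j.1).toLinearMap from rfl,
    Submodule.map_comp]
  exact (Submodule.equivMapOfInjective _ H.injective _).finrank_eq.symm

theorem rankOfClassGT_le [FiniteDimensional ℝ W₀] (H : IsNormalSystem U Φ ι f a σ) {j : J1 2 F}
    (hj : j.1 ∈ U) (b : Module.Basis (Fin 2) ℝ (Coord 2)) (k : ℕ) :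
    rankOfClassGT Φ j b k ≤ Module.finrank ℝ W₀ := by
  rw [H.rankOfClassGT_eq hj]
  exact Submodule.finrank_le _

theorem rankOfClassGT_zero (H : IsNormalSystem U Φ ι f a σ) {j : J1 2 F} (hj : j.1 ∈ U)
    (b : Module.Basis (Fin 2) ℝ (Coord 2)) :
    rankOfClassGT Φ j b 0 = Module.finrank ℝ W₀ := by
  have h0 : derivsOfClassGT F b 0 = ⊤ := by
    ext A; simp [derivsOfClassGT]
  rw [H.rankOfClassGT_eq hj, h0, Submodule.map_top, LinearMap.range_eq_top.2 (H.surjective_σ hj),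
    finrank_top]

theorem rankOfClassGT_two_le (b : Module.Basis (Fin 2) ℝ (Coord 2)) (j : J1 2 F) {k : ℕ}
    (hk : 2 ≤ k) : rankOfClassGT Φ j b k = 0 := by
  have h0 : derivsOfClassGT F b k = ⊥ := by
    rw [eq_bot_iff]
    intro A hA
    have : A.toLinearMap = 0 := b.ext fun i => hA i (i.2.trans_le hk)
    ext1 v
    exact congrArg (fun g => g v) this
  rw [rankOfClassGT, h0, Submodule.map_bot, finrank_bot]

/-- A basis that starts with a vector annihilated by a noncharacteristic covector is
`δ`-regular, with all equations of class `2`. -/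
theorem exists_isDeltaRegular [FiniteDimensional ℝ W₀] (H : IsNormalSystem U Φ ι f a σ)
    {j : J1 2 F} (hj : j.1 ∈ U) :
    ∃ b, IsDeltaRegular Φ j b ∧ rankOfClassGT Φ j b 1 = Module.finrank ℝ W₀ := by
  obtain ⟨y, hy, hs⟩ := H.normal _ hj
  obtain ⟨b, hb⟩ := exists_basis_zero_eq hy
  have h1 : rankOfClassGT Φ j b 1 = Module.finrank ℝ W₀ := by
    rw [H.rankOfClassGT_eq hj]
    have : (derivsOfClassGT F b 1).map (σ j.1).toLinearMap = ⊤ := by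
      rw [eq_top_iff]
      intro c _
      obtain ⟨v, hv⟩ := hs c
      refine ⟨(perp y).smulRight v, fun i hi => ?_, hv⟩
      obtain rfl : i = 0 := by omega
      simp [hb, perp_self]
    rw [this, finrank_top]
  refine ⟨b, fun b' k => ?_, h1⟩
  rcases Nat.lt_or_ge k 2 with hk | hk
  · interval_cases k
    · rw [H.rankOfClassGT_zero hj b]; exact H.rankOfClassGT_le hj _ _
    · rw [h1]; exact H.rankOfClassGT_le hj _ _
  · rw [rankOfClassGT_two_le _ _ hk, rankOfClassGT_two_le _ _ hk]

theorem alphaClass_eq [FiniteDimensional ℝ W₀] (H : IsNormalSystem U Φ ι f a σ)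
    {j : J1 2 F} (hj : j.1 ∈ U) {b : Module.Basis (Fin 2) ℝ (Coord 2)}
    (hb : IsDeltaRegular Φ j b) (k : Fin 2) :
    alphaClass Φ j b k =
      ![(Module.finrank ℝ F : ℤ), (Module.finrank ℝ F : ℤ) - Module.finrank ℝ W₀] k := by
  obtain ⟨b', -, h1⟩ := H.exists_isDeltaRegular hj
  have h2 : rankOfClassGT Φ j b 1 = Module.finrank ℝ W₀ :=
    le_antisymm (H.rankOfClassGT_le hj _ _) (h1 ▸ hb b' 1)
  fin_cases k
  · simp [alphaClass, betaClass, H.rankOfClassGT_zero hj, h2]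
  · simp [alphaClass, betaClass, rankOfClassGT_two_le, h2]

/-- In a frame dual to `η`, `ξ`, a symmetric `F`-valued form has three components in `F`. -/
def symmForm (F : Type) [NormedAddCommGroup F] [NormedSpace ℝ F] (η ξ : Coord 2 →L[ℝ] ℝ) :
    F × F × F →ₗ[ℝ] Coord 2 →L[ℝ] Coord 2 →L[ℝ] F where
  toFun p := η.smulRight (η.smulRight p.1 + ξ.smulRight p.2.1) +
    ξ.smulRight (η.smulRight p.2.1 + ξ.smulRight p.2.2)
  map_add' p q := by
    ext v w; simp; module
  map_smul' r p := by
    ext v w; simp; module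

theorem symmForm_apply (η ξ : Coord 2 →L[ℝ] ℝ) (p : F × F × F) (v : Coord 2) :
    symmForm F η ξ p v = η v • (η.smulRight p.1 + ξ.smulRight p.2.1) +
      ξ v • (η.smulRight p.2.1 + ξ.smulRight p.2.2) := rfl

/-- The `2 dim W₀` equations that cut `M_2` out of the `3 dim F`-dimensional space of symmetric
forms are independent. -/
theorem finrank_prolongedSymbol [FiniteDimensional ℝ F] [FiniteDimensional ℝ W₀]
    (H : IsNormalSystem U Φ ι f a σ) {j : J1 2 F} (hj : j.1 ∈ U) :
    Module.finrank ℝ (prolongedSymbol Φ j) + 2 * Module.finrank ℝ W₀ =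
      3 * Module.finrank ℝ F := by
  obtain ⟨y, hy, hs⟩ := H.normal _ hj
  obtain ⟨z, η, hyz, hηy, hηz, hdec⟩ := exists_dual_frame hy
  have hyy := perp_self y
  set ξ := perp y with hξ
  set S := σ j.1 with hS
  let T : F × F × F →ₗ[ℝ] W₀ × W₀ :=
    { toFun := fun p => (S (symmForm F η ξ p y), S (symmForm F η ξ p z))
      map_add' := fun p q => by simp
      map_smul' := fun r p => by simp }
  have hy' : ∀ p : F × F × F, symmForm F η ξ p y = η.smulRight p.1 + ξ.smulRight p.2.1 := by
    intro p; rw [symmForm_apply, hηy, hyy, one_smul, zero_smul, add_zero]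
  have hz' : ∀ p : F × F × F, symmForm F η ξ p z = η.smulRight p.2.1 + ξ.smulRight p.2.2 := by
    intro p; rw [symmForm_apply, hηz, hyz, one_smul, zero_smul, zero_add]
  have hT : Function.Surjective T := by
    rintro ⟨c, d⟩
    obtain ⟨p₁, h₁⟩ := hs c
    obtain ⟨p₂, h₂⟩ := hs (d - S (η.smulRight p₁))
    refine ⟨(0, p₁, p₂), Prod.ext ?_ ?_⟩
    · change S (symmForm F η ξ (0, p₁, p₂) y) = c
      rw [hy', ← h₁]
      congr 1; ext1; simp
    · change S (symmForm F η ξ (0, p₁, p₂) z) = d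
      rw [hz', map_add]
      exact (congrArg (S (η.smulRight p₁) + ·) h₂).trans (add_sub_cancel _ _)
  have hinj : Function.Injective (symmForm F η ξ) := by
    rw [injective_iff_map_eq_zero]
    intro p hp
    have h1 := hy' p
    have h2 := hz' p
    rw [hp, zero_apply] at h1 h2
    have e1 := congrArg (fun A => A y) h1
    have e2 := congrArg (fun A => A z) h1
    have e3 := congrArg (fun A => A z) h2
    simp [hηy, hyy, hηz, hyz] at e1 e2 e3
    exact Prod.ext e1.symm (Prod.ext e2.symm e3.symm)
  have hmap : prolongedSymbol Φ j = (LinearMap.ker T).map (symmForm F η ξ) := by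
    ext B
    have hmem : B ∈ prolongedSymbol Φ j ↔ (∀ v w, B v w = B w v) ∧ ∀ v, S (B v) = 0 := by
      refine and_congr_right fun _ => forall_congr' fun v => ?_
      rw [H.symbolMap_eq hj]
      exact map_eq_zero_iff ι H.injective
    rw [hmem]
    constructor
    · rintro ⟨hsym, hB⟩
      have hBeq : symmForm F η ξ (B y y, B y z, B z z) = B := by
        ext1 v
        ext1 w
        conv_rhs => rw [hdec v, hdec w]
        rw [symmForm_apply]
        simp only [add_apply, smul_apply, ContinuousLinearMap.smulRight_apply, map_add, map_smul,
          hsym z y]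
        module
      refine ⟨(B y y, B y z, B z z), ?_, hBeq⟩
      exact Prod.ext ((congrArg (fun A => S (A y)) hBeq).trans (hB y))
        ((congrArg (fun A => S (A z)) hBeq).trans (hB z))
    · rintro ⟨p, hp, rfl⟩
      refine ⟨fun v w => ?_, fun v => ?_⟩
      · simp only [symmForm_apply, add_apply, smul_apply, ContinuousLinearMap.smulRight_apply]
        module
      · have h1 : S (symmForm F η ξ p y) = 0 := congrArg Prod.fst hp
        have h2 : S (symmForm F η ξ p z) = 0 := congrArg Prod.snd hp
        rw [hdec v, map_add, map_add, map_smul, map_smul, map_smul, map_smul, h1, h2, smul_zero,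
          smul_zero, add_zero]
  have hrn := T.finrank_range_add_finrank_ker
  rw [LinearMap.range_eq_top.2 hT, finrank_top] at hrn
  rw [hmap, ← (Submodule.equivMapOfInjective _ hinj _).finrank_eq]
  simp only [Module.finrank_prod] at hrn
  omega

theorem isInvolutiveSystem [FiniteDimensional ℝ F] [FiniteDimensional ℝ W₀]
    (H : IsNormalSystem U Φ ι f a σ) : IsInvolutiveSystem U Φ := by
  refine ⟨fun x hx => ?_, fun j hj _ => ?_, H.formallyIntegrable⟩
  · obtain ⟨P, hP⟩ := H.surjective_σ hx (-f x)
    refine ⟨0, P, ?_⟩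
    rw [H.eq _ hx]
    simp [hP]
  · obtain ⟨b, hb, -⟩ := H.exists_isDeltaRegular hj
    refine ⟨b, hb, ?_⟩
    have := H.finrank_prolongedSymbol hj
    rw [Fin.sum_univ_two, H.alphaClass_eq hj hb, H.alphaClass_eq hj hb]
    simp
    omega

theorem hasSymbolCharacters [FiniteDimensional ℝ W₀] (H : IsNormalSystem U Φ ι f a σ) :
    HasSymbolCharacters U Φ
      ![(Module.finrank ℝ F : ℤ), (Module.finrank ℝ F : ℤ) - Module.finrank ℝ W₀] :=
  fun _ hj _ _ hb k => H.alphaClass_eq hj hb k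

end IsNormalSystem

end Normal

/-! ### The Pfaffian system of a normal system -/

section Pfaff

variable {F W W₀ : Type} [NormedAddCommGroup F] [NormedSpace ℝ F]
  [NormedAddCommGroup W] [NormedSpace ℝ W] [NormedAddCommGroup W₀] [NormedSpace ℝ W₀]

theorem pfaffForm_apply (Φ : J1 2 F → W) (j v : J1 2 F) :
    pfaffForm Φ j v = (fderiv ℝ Φ j v, v.2.1 - j.2.2 v.1) := rfl

/-- Since `d(dΦ) = 0`, adjoining `dΦ` to a form contributes nothing to its exterior derivative. -/
theorem extDerivOne_fderiv_prod {X : Type} [NormedAddCommGroup X] [NormedSpace ℝ X] {Φ : X → W}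
    {c : X → X →L[ℝ] F} {j : X} (hΦ : ContDiffAt ℝ ∞ Φ j) (hc : DifferentiableAt ℝ c j) (v w : X) :
    extDerivOne (fun q => (fderiv ℝ Φ q).prod (c q)) j v w = (0, extDerivOne c j v w) := by
  have dΦ : DifferentiableAt ℝ (fderiv ℝ Φ) j :=
    (hΦ.fderiv_right (m := ∞) (by simp)).differentiableAt (by simp)
  have hsplit : (fun q => (fderiv ℝ Φ q).prod (c q)) = fun q =>
      ContinuousLinearMap.inl ℝ W F ∘L fderiv ℝ Φ q + ContinuousLinearMap.inr ℝ W F ∘L c q :=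
    funext fun q => ContinuousLinearMap.ext fun v => by simp
  have dΘ : DifferentiableAt ℝ (fun q => (fderiv ℝ Φ q).prod (c q)) j := by
    rw [hsplit]
    exact ((differentiableAt_const _).clm_comp dΦ).add ((differentiableAt_const _).clm_comp hc)
  have key : ∀ v w, fderiv ℝ (fun q => (fderiv ℝ Φ q).prod (c q)) j v w =
      (fderiv ℝ (fderiv ℝ Φ) j v w, fderiv ℝ c j v w) := by
    intro v w
    have e1 := dΘ.hasFDerivAt.clm_apply (hasFDerivAt_const w j)
    have e2 := (dΦ.hasFDerivAt.clm_apply (hasFDerivAt_const w j)).prodMk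
      (hc.hasFDerivAt.clm_apply (hasFDerivAt_const w j))
    have e3 := congrArg (fun A => A v) (e1.unique e2)
    simpa using e3
  have hs : IsSymmSndFDerivAt ℝ Φ j := (contDiffAt_infty.1 hΦ 2).isSymmSndFDerivAt (by simp)
  rw [extDerivOne, key, key, hs.eq v w, Prod.mk_sub_mk, sub_self]
  rfl

theorem hasFDerivAt_sub_clm_comp {A X : Type} [NormedAddCommGroup A] [NormedSpace ℝ A]
    [NormedAddCommGroup X] [NormedSpace ℝ X] (u : X →L[ℝ] F) (π : X →L[ℝ] A →L[ℝ] F) (p : X →L[ℝ] A)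
    (j : X) : ∃ T : X →L[ℝ] X →L[ℝ] F, HasFDerivAt (fun q => u - π q ∘L p) T j ∧
      ∀ v w, T v w = -(π v (p w)) := by
  let K : (A →L[ℝ] F) →L[ℝ] X →L[ℝ] F := (ContinuousLinearMap.compL ℝ X A F).flip p
  exact ⟨-(K ∘L π), (K ∘L π).hasFDerivAt.const_sub u, fun v w => rfl⟩

theorem extDerivOne_pfaffForm {Φ : J1 2 F → W} {j : J1 2 F} (hΦ : ContDiffAt ℝ ∞ Φ j)
    (v w : J1 2 F) :
    extDerivOne (pfaffForm Φ) j v w = (0, w.2.2 v.1 - v.2.2 w.1) := by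
  obtain ⟨T, hT, hTv⟩ := hasFDerivAt_sub_clm_comp
    (ContinuousLinearMap.fst ℝ F (Coord 2 →L[ℝ] F) ∘L
      ContinuousLinearMap.snd ℝ (Coord 2) (F × (Coord 2 →L[ℝ] F)))
    (ContinuousLinearMap.snd ℝ F (Coord 2 →L[ℝ] F) ∘L
      ContinuousLinearMap.snd ℝ (Coord 2) (F × (Coord 2 →L[ℝ] F)))
    (ContinuousLinearMap.fst ℝ (Coord 2) (F × (Coord 2 →L[ℝ] F))) j
  change HasFDerivAt contactForm T j at hT
  refine (extDerivOne_fderiv_prod hΦ hT.differentiableAt v w).trans ?_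
  rw [extDerivOne, hT.fderiv, hTv, hTv, neg_sub_neg]
  rfl

theorem extDerivOne_eq_zero_of_mem_span {X Z : Type} [NormedAddCommGroup X] [NormedSpace ℝ X]
    [NormedAddCommGroup Z] [NormedSpace ℝ Z] (Θ : X → X →L[ℝ] Z) (p v : X) {s : Set X}
    (h : ∀ w ∈ s, extDerivOne Θ p v w = 0) {w : X} (hw : w ∈ Submodule.span ℝ s) :
    extDerivOne Θ p v w = 0 := by
  induction hw using Submodule.span_induction with
  | mem w hw => exact h w hw
  | zero => simp [extDerivOne]
  | add w w' _ _ hw hw' =>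
    simp only [extDerivOne, map_add, add_apply] at *
    rw [add_sub_add_comm, hw, hw', add_zero]
  | smul c w _ hw =>
    simp only [extDerivOne, map_smul, smul_apply] at *
    rw [← smul_sub, hw, smul_zero]

theorem finrank_J1 [FiniteDimensional ℝ F] :
    Module.finrank ℝ (J1 2 F) = 2 + 3 * Module.finrank ℝ F := by
  have h : Module.finrank ℝ (Coord 2 →L[ℝ] F) = 2 * Module.finrank ℝ F := by
    rw [← (LinearMap.toContinuousLinearMap (𝕜 := ℝ) (E := Coord 2) (F' := F)).finrank_eq,
      Module.finrank_linearMap]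
    simp
  simp only [Module.finrank_prod, h, Module.finrank_fin_fun]
  ring

theorem isUnit_surjective {T : W₀ →L[ℝ] W₀} (hT : IsUnit T) : Function.Surjective T := by
  obtain ⟨u, rfl⟩ := hT
  intro c
  refine ⟨(↑u⁻¹ : W₀ →L[ℝ] W₀) c, ?_⟩
  exact congrArg (fun A : W₀ →L[ℝ] W₀ => A c) u.mul_inv

variable {U : Set (Coord 2)} {Φ : J1 2 F → W} {ι : W₀ →L[ℝ] W} {f : Coord 2 → W₀}
  {a : Coord 2 → F →L[ℝ] W₀} {σ : Coord 2 → (Coord 2 →L[ℝ] F) →L[ℝ] W₀}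

namespace IsNormalSystem

theorem eventually_mem (H : IsNormalSystem U Φ ι f a σ) {j : J1 2 F} (hj : j.1 ∈ U) :
    ∀ᶠ q : J1 2 F in 𝓝 j, q.1 ∈ U :=
  continuous_fst.continuousAt.eventually (H.isOpen.mem_nhds hj)

/-- `dΦ` is the image under `ι` of the differential `D` of the independent equations, whose
restriction to the fibres is given by the coefficients `a` and `σ`. -/
theorem exists_fderiv_eq (H : IsNormalSystem U Φ ι f a σ) {j : J1 2 F} (hj : j.1 ∈ U) :
    ContDiffAt ℝ ∞ Φ j ∧ ∃ D : J1 2 F →L[ℝ] W₀, fderiv ℝ Φ j = ι ∘L D ∧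
      ∀ v B, D (0, v, B) = a j.1 v + σ j.1 B := by
  set E : J1 2 F → W₀ := fun q => f q.1 + a q.1 q.2.1 + σ q.1 q.2.2 with hE
  have hU := H.isOpen.mem_nhds hj
  have cE : ContDiffAt ℝ ∞ E j := by
    have c1 : ContDiffAt ℝ ∞ (fun q : J1 2 F => q.1) j := contDiffAt_fst
    have c2 : ContDiffAt ℝ ∞ (fun q : J1 2 F => q.2.1) j := by fun_prop
    have c3 : ContDiffAt ℝ ∞ (fun q : J1 2 F => q.2.2) j := by fun_prop
    exact (((H.contDiffOn_f.contDiffAt hU).comp j c1).add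
      (((H.contDiffOn_a.contDiffAt hU).comp j c1).clm_apply c2)).add
      (((H.contDiffOn_σ.contDiffAt hU).comp j c1).clm_apply c3)
  have he : (fun q => ι (E q)) =ᶠ[𝓝 j] Φ := by
    filter_upwards [H.eventually_mem hj] with q hq
    exact (H.eq q hq).symm
  have cι : ContDiffAt ℝ ∞ (fun q => ι (E q)) j := ι.contDiff.contDiffAt.comp j cE
  have dE : DifferentiableAt ℝ E j := cE.differentiableAt (by simp)
  refine ⟨cι.congr_of_eventuallyEq he.symm, fderiv ℝ E j, ?_, fun v B => ?_⟩
  · rw [← he.fderiv_eq]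
    exact (ι.hasFDerivAt.comp j dE.hasFDerivAt).fderiv
  · let m : F × (Coord 2 →L[ℝ] F) →L[ℝ] J1 2 F := ContinuousLinearMap.inr ℝ (Coord 2) _
    have h1 : HasFDerivAt (fun p => E (j + m p)) (fderiv ℝ E j ∘L m) 0 := by
      have h2 : HasFDerivAt (fun p => j + m p) m 0 := m.hasFDerivAt.const_add j
      have h3 : HasFDerivAt E (fderiv ℝ E j) (j + m 0) := by simpa using dE.hasFDerivAt
      exact HasFDerivAt.comp (g := E) (f := fun p => j + m p) 0 h3 h2
    let T : F × (Coord 2 →L[ℝ] F) →L[ℝ] W₀ := (a j.1).coprod (σ j.1)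
    have h4 : (fun p => E (j + m p)) = fun p => E j + T p := by
      funext p
      simp [E, m, T]
      abel
    have h5 : HasFDerivAt (fun p => E (j + m p)) T 0 := by
      rw [h4]; exact T.hasFDerivAt.const_add _
    have := congrArg (fun A => A (v, B)) (h1.unique h5)
    simpa [m, T] using this

theorem mem_polarSpace_iff (H : IsNormalSystem U Φ ι f a σ) {j : J1 2 F} (hj : j.1 ∈ U)
    {D : J1 2 F →L[ℝ] W₀} (hD : fderiv ℝ Φ j = ι ∘L D) {k : ℕ} (e : Fin k → J1 2 F) (v : J1 2 F) :
    v ∈ polarSpace (pfaffForm Φ) j (Submodule.span ℝ (Set.range e)) ↔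
      D v = 0 ∧ v.2.1 - j.2.2 v.1 = 0 ∧ ∀ i, (e i).2.2 v.1 - v.2.2 (e i).1 = 0 := by
  have h1 : v ∈ polarSpace (pfaffForm Φ) j (Submodule.span ℝ (Set.range e)) ↔
      pfaffForm Φ j v = 0 ∧ ∀ w ∈ Submodule.span ℝ (Set.range e),
        extDerivOne (pfaffForm Φ) j v w = 0 := Iff.rfl
  have h2 : (∀ w ∈ Submodule.span ℝ (Set.range e), extDerivOne (pfaffForm Φ) j v w = 0) ↔
      ∀ i, (e i).2.2 v.1 - v.2.2 (e i).1 = 0 := by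
    constructor
    · intro h i
      have := h (e i) (Submodule.subset_span ⟨i, rfl⟩)
      rw [extDerivOne_pfaffForm (H.exists_fderiv_eq hj).1] at this
      exact congrArg Prod.snd this
    · intro h w hw
      refine extDerivOne_eq_zero_of_mem_span _ _ _ ?_ hw
      rintro _ ⟨i, rfl⟩
      rw [extDerivOne_pfaffForm (H.exists_fderiv_eq hj).1, h i]
      rfl
  rw [h1, h2, pfaffForm_apply, hD, Prod.mk_eq_zero, and_assoc]
  exact and_congr_left fun _ => map_eq_zero_iff ι H.injective

theorem isIntegralFrame_iff (H : IsNormalSystem U Φ ι f a σ) {j : J1 2 F} (hj : j.1 ∈ U)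
    {D : J1 2 F →L[ℝ] W₀} (hD : fderiv ℝ Φ j = ι ∘L D) {k : ℕ} (e : Fin k → J1 2 F) :
    IsIntegralFrame (pfaffForm Φ) j e ↔ LinearIndependent ℝ e ∧
      (∀ i, D (e i) = 0 ∧ (e i).2.1 - j.2.2 (e i).1 = 0) ∧
      ∀ i i', (e i').2.2 (e i).1 - (e i).2.2 (e i').1 = 0 := by
  refine and_congr_right fun _ => and_congr (forall_congr' fun i => ?_)
    (forall₂_congr fun i i' => ?_)
  · rw [pfaffForm_apply, hD, Prod.mk_eq_zero]
    exact and_congr_left fun _ => map_eq_zero_iff ι H.injective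
  · rw [extDerivOne_pfaffForm (H.exists_fderiv_eq hj).1, Prod.mk_eq_zero]
    simp

/-- If the polar equations are independent, the polar rank is their number: `dim W₀` for `dΦ`,
`dim F` for the contact form, and `dim F` for each vector of the frame. -/
theorem polarRank_eq_of_surjective (H : IsNormalSystem U Φ ι f a σ) {j : J1 2 F} (hj : j.1 ∈ U)
    {D : J1 2 F →L[ℝ] W₀} (hD : fderiv ℝ Φ j = ι ∘L D) {k : ℕ} (e : Fin k → J1 2 F)
    (hs : ∀ (c : W₀) (b : F) (d : Fin k → F), ∃ v : J1 2 F, D v = c ∧ v.2.1 - j.2.2 v.1 = b ∧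
      ∀ i, (e i).2.2 v.1 - v.2.2 (e i).1 = d i) [FiniteDimensional ℝ F] [FiniteDimensional ℝ W₀] :
    polarRank (pfaffForm Φ) j e =
      Module.finrank ℝ W₀ + Module.finrank ℝ F + k * Module.finrank ℝ F := by
  let T : J1 2 F →ₗ[ℝ] W₀ × F × (Fin k → F) :=
    { toFun := fun v => (D v, v.2.1 - j.2.2 v.1, fun i => (e i).2.2 v.1 - v.2.2 (e i).1)
      map_add' := fun v w => by
        ext <;> simp <;> abel
      map_smul' := fun r v => by
        ext <;> simp [smul_sub] }
  have hker : polarSpace (pfaffForm Φ) j (Submodule.span ℝ (Set.range e)) = LinearMap.ker T := by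
    ext v
    rw [H.mem_polarSpace_iff hj hD, LinearMap.mem_ker]
    simp [T, Prod.ext_iff, funext_iff]
  have hT : Function.Surjective T := by
    rintro ⟨c, b, d⟩
    obtain ⟨v, h1, h2, h3⟩ := hs c b d
    exact ⟨v, Prod.ext h1 (Prod.ext h2 (funext h3))⟩
  rw [polarRank, hker, (T.quotKerEquivOfSurjective hT).finrank_eq]
  simp [Module.finrank_prod, Module.finrank_pi_fintype]
  ring

theorem polarRank_zero [FiniteDimensional ℝ F] [FiniteDimensional ℝ W₀]
    (H : IsNormalSystem U Φ ι f a σ) {j : J1 2 F} (hj : j.1 ∈ U) (e : Fin 0 → J1 2 F) :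
    polarRank (pfaffForm Φ) j e = Module.finrank ℝ W₀ + Module.finrank ℝ F := by
  obtain ⟨-, D, hD, hDv⟩ := H.exists_fderiv_eq hj
  rw [H.polarRank_eq_of_surjective hj hD e, Nat.zero_mul, Nat.add_zero]
  intro c b d
  obtain ⟨B, hB⟩ := H.surjective_σ hj (c - a j.1 b)
  exact ⟨(0, b, B), by rw [hDv, hB, add_sub_cancel], by simp, fun i => i.elim0⟩

/-- At a line whose annihilator is noncharacteristic the polar equations are independent. -/
theorem polarRank_one [FiniteDimensional ℝ F] [FiniteDimensional ℝ W₀]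
    (H : IsNormalSystem U Φ ι f a σ) {j : J1 2 F} (hj : j.1 ∈ U) (e : Fin 1 → J1 2 F)
    (he : (e 0).1 ≠ 0)
    (hs : Function.Surjective fun v : F => σ j.1 ((perp (e 0).1).smulRight v)) :
    polarRank (pfaffForm Φ) j e = Module.finrank ℝ W₀ + 2 * Module.finrank ℝ F := by
  obtain ⟨-, D, hD, hDv⟩ := H.exists_fderiv_eq hj
  rw [H.polarRank_eq_of_surjective hj hD e]
  · ring
  intro c b d
  obtain ⟨z, η, -, hη, -, -⟩ := exists_dual_frame he
  obtain ⟨v, hv⟩ := hs (c - a j.1 b + σ j.1 (η.smulRight (d 0)))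
  refine ⟨(0, b, (perp (e 0).1).smulRight v - η.smulRight (d 0)), ?_, by simp, fun i => ?_⟩
  · rw [hDv, map_sub]
    change σ j.1 ((perp (e 0).1).smulRight v) = _ at hv
    rw [hv]
    abel
  · obtain rfl : i = 0 := Subsingleton.elim _ _
    simp [perp_self, hη]

/-- An integral plane transversal to the fibres is its own polar space. -/
theorem polarRank_two [FiniteDimensional ℝ F] (H : IsNormalSystem U Φ ι f a σ) {j : J1 2 F}
    (hj : j.1 ∈ U) (e : Fin 2 → J1 2 F) (he : IsIntegralFrame (pfaffForm Φ) j e)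
    (hx : LinearIndependent ℝ fun i => (e i).1) :
    polarRank (pfaffForm Φ) j e = 3 * Module.finrank ℝ F := by
  obtain ⟨-, D, hD, hDv⟩ := H.exists_fderiv_eq hj
  obtain ⟨hli, h1, h2⟩ := (H.isIntegralFrame_iff hj hD e).1 he
  have hle : Submodule.span ℝ (Set.range e) ≤
      polarSpace (pfaffForm Φ) j (Submodule.span ℝ (Set.range e)) := by
    rw [Submodule.span_le]
    rintro _ ⟨i, rfl⟩
    exact (H.mem_polarSpace_iff hj hD e _).2 ⟨(h1 i).1, (h1 i).2, fun i' => h2 i i'⟩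
  let b := basisOfLinearIndependentOfCardEqFinrank hx (by simp)
  have hb : ∀ i, b i = (e i).1 := fun i => by simp [b]
  have heq : polarSpace (pfaffForm Φ) j (Submodule.span ℝ (Set.range e)) =
      Submodule.span ℝ (Set.range e) := by
    refine le_antisymm (fun v hv => ?_) hle
    set w : J1 2 F := ∑ i, b.repr v.1 i • e i with hw
    have hwm : w ∈ Submodule.span ℝ (Set.range e) :=
      Submodule.sum_mem _ fun i _ => Submodule.smul_mem _ _ (Submodule.subset_span ⟨i, rfl⟩)
    have hd := Submodule.sub_mem _ hv (hle hwm)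
    have hx0 : (v - w).1 = 0 := by
      have hw1 : w.1 = v.1 := by
        rw [hw, Prod.fst_sum]
        conv_rhs => rw [← b.sum_repr v.1]
        exact Finset.sum_congr rfl fun i _ => by rw [hb]; rfl
      rw [Prod.fst_sub, hw1, sub_self]
    obtain ⟨-, hu, hP⟩ := (H.mem_polarSpace_iff hj hD e _).1 hd
    rw [hx0, map_zero, sub_zero] at hu
    have hP0 : (v - w).2.2 = 0 := by
      have : (v - w).2.2.toLinearMap = 0 := b.ext fun i => by
        have := hP i
        rw [hx0, map_zero, zero_sub, neg_eq_zero] at this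
        rw [hb]
        exact this
      ext1 y
      exact congrArg (fun g => g y) this
    have : v - w = 0 := Prod.ext hx0 (Prod.ext hu hP0)
    rwa [sub_eq_zero.1 this]
  have hq := Submodule.finrank_quotient_add_finrank (R := ℝ) (M := J1 2 F)
    (Submodule.span ℝ (Set.range e))
  rw [finrank_span_eq_card hli, finrank_J1, Fintype.card_fin] at hq
  rw [polarRank, heq]
  omega

theorem linearIndependent_singleton_of_fst_ne_zero {e : Fin 1 → J1 2 F} (he : (e 0).1 ≠ 0) :
    LinearIndependent ℝ e := by
  rw [linearIndependent_unique_iff]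
  exact fun h => he (congrArg Prod.fst h)

/-- A regular integral line transversal to the fibres has the polar rank of the noncharacteristic
lines, since these are dense among the integral lines. -/
theorem polarRank_of_isRegularFrame [FiniteDimensional ℝ F] [FiniteDimensional ℝ W₀]
    (H : IsNormalSystem U Φ ι f a σ) {j : J1 2 F} (hj : j.1 ∈ U) {e : Fin 1 → J1 2 F}
    (he : (e 0).1 ≠ 0) (hr : IsRegularFrame (pfaffForm Φ) j e) :
    polarRank (pfaffForm Φ) j e = Module.finrank ℝ W₀ + 2 * Module.finrank ℝ F := by
  obtain ⟨-, D, hD, hDv⟩ := H.exists_fderiv_eq hj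
  obtain ⟨hint, hev⟩ := hr
  obtain ⟨-, h1, -⟩ := (H.isIntegralFrame_iff hj hD e).1 hint
  obtain ⟨y, hy, hs⟩ := H.normal _ hj
  obtain ⟨s, hs'⟩ := exists_rightInverse_symbol hs
  obtain ⟨B, hB⟩ := H.surjective_σ hj (-D (y, j.2.2 y, 0))
  -- an integral vector in the direction `y`
  set k : J1 2 F := (y, j.2.2 y, B) with hk
  have hDk : D k = 0 := by
    have : k = (y, j.2.2 y, 0) + (0, 0, B) := by simp [hk]
    rw [this, map_add, hDv, hB, map_zero, zero_add, add_neg_cancel]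
  let c : ℝ → J1 2 F × (Fin 1 → J1 2 F) := fun t => (j, fun _ => e 0 + t • k)
  have hc : ContinuousAt c 0 := by
    have : Continuous c := by fun_prop
    exact this.continuousAt
  have hc0 : c 0 = (j, e) := by
    refine Prod.ext rfl (funext fun i => ?_)
    rw [Subsingleton.elim i 0]
    simp [c]
  have hev1 : ∀ᶠ t in 𝓝 (0 : ℝ), IsIntegralFrame (pfaffForm Φ) (c t).1 (c t).2 →
      polarRank (pfaffForm Φ) (c t).1 (c t).2 = polarRank (pfaffForm Φ) j e := by
    have := hc.tendsto
    rw [hc0] at this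
    exact this.eventually hev
  have hne : ∀ᶠ t in 𝓝 (0 : ℝ), (e 0 + t • k).1 ≠ 0 := by
    have : Continuous fun t : ℝ => (e 0 + t • k).1 := by fun_prop
    exact this.continuousAt.eventually_ne (by simpa using he)
  -- `A + t` is invertible apart from finitely many `t`, and it is the symbol in direction `t`.
  let A : W₀ →ₗ[ℝ] W₀ := (σ j.1).toLinearMap ∘ₗ
    (ContinuousLinearMap.smulRightL ℝ (Coord 2) F (perp (e 0).1)).toLinearMap ∘ₗ s.toLinearMap
  have hA : ∀ d, A d = σ j.1 ((perp (e 0).1).smulRight (s d)) := fun d => rfl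
  have hfin : {t : ℝ | Module.End.HasEigenvalue A (-t)}.Finite :=
    (Module.End.finite_hasEigenvalue A).preimage neg_injective.injOn
  have hev2 : ∀ᶠ t in 𝓝[≠] (0 : ℝ), ¬ Module.End.HasEigenvalue A (-t) := by
    have := (hfin.subset Set.sdiff_subset :
      ({t : ℝ | Module.End.HasEigenvalue A (-t)} \ {0}).Finite)
    have h3 := this.isClosed.isOpen_compl.mem_nhds (x := (0 : ℝ)) (by simp)
    rw [eventually_nhdsWithin_iff]
    filter_upwards [h3] with t ht ht0 hh
    exact ht ⟨hh, ht0⟩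
  obtain ⟨t, ⟨ht1, ht2⟩, ht3⟩ :=
    (((hev1.and hne).filter_mono nhdsWithin_le_nhds).and hev2).exists
  have hsurj : Function.Surjective fun v : F => σ j.1 ((perp (e 0 + t • k).1).smulRight v) := by
    have hinj : Function.Injective (A + t • (LinearMap.id : W₀ →ₗ[ℝ] W₀)) := by
      rw [injective_iff_map_eq_zero]
      intro d hd
      by_contra hd0
      refine ht3 (Module.End.hasEigenvalue_of_hasEigenvector (x := d) ⟨?_, hd0⟩)
      rw [Module.End.mem_eigenspace_iff]
      have : A d + t • d = 0 := hd
      rw [eq_neg_of_add_eq_zero_left this, neg_smul]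
    intro d
    obtain ⟨d', hd'⟩ := LinearMap.injective_iff_surjective.1 hinj d
    refine ⟨s d', ?_⟩
    rw [← hd']
    have : (perp (e 0 + t • k).1).smulRight (s d') =
        (perp (e 0).1).smulRight (s d') + t • (perp y).smulRight (s d') := by
      ext1 v
      simp [hk]
      module
    simp only [this, map_add, map_smul, hs']
    rfl
  have hint' : IsIntegralFrame (pfaffForm Φ) (c t).1 (c t).2 := by
    refine (H.isIntegralFrame_iff hj hD _).2
      ⟨linearIndependent_singleton_of_fst_ne_zero ht2, fun i => ⟨?_, ?_⟩, fun i i' => sub_self _⟩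
    · simp only [c, map_add, map_smul, (h1 0).1, hDk, smul_zero, add_zero]
    · have := (h1 0).2
      simp only [c, hk, Prod.fst_add, Prod.snd_add, Prod.smul_fst, Prod.smul_snd, map_add, map_smul]
      rw [sub_eq_zero.1 this, sub_self]
  rw [← ht1 hint']
  exact H.polarRank_one hj (c t).2 ht2 hsurj

theorem isRegularFrame_zero [FiniteDimensional ℝ F] [FiniteDimensional ℝ W₀]
    (H : IsNormalSystem U Φ ι f a σ) {j : J1 2 F} (hj : j.1 ∈ U) (e : Fin 0 → J1 2 F) :
    IsRegularFrame (pfaffForm Φ) j e := by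
  refine ⟨⟨linearIndependent_empty_type, fun i => i.elim0, fun i => i.elim0⟩, ?_⟩
  have : ∀ᶠ q : J1 2 F × (Fin 0 → J1 2 F) in 𝓝 (j, e), q.1.1 ∈ U :=
    continuousAt_fst.eventually (H.eventually_mem hj)
  filter_upwards [this] with q hq _
  rw [H.polarRank_zero hj, H.polarRank_zero hq]

/-- Noncharacteristic integral lines are regular, because being noncharacteristic is an open
condition. -/
theorem isRegularFrame_one [FiniteDimensional ℝ F] [FiniteDimensional ℝ W₀]
    (H : IsNormalSystem U Φ ι f a σ) {j : J1 2 F} (hj : j.1 ∈ U) {e : Fin 1 → J1 2 F}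
    (he : (e 0).1 ≠ 0) (hint : IsIntegralFrame (pfaffForm Φ) j e)
    (hs : Function.Surjective fun v : F => σ j.1 ((perp (e 0).1).smulRight v)) :
    IsRegularFrame (pfaffForm Φ) j e := by
  refine ⟨hint, ?_⟩
  obtain ⟨s, hs'⟩ := exists_rightInverse_symbol hs
  -- invertibility is an open condition
  let T : J1 2 F × (Fin 1 → J1 2 F) → W₀ →L[ℝ] W₀ := fun q =>
    σ q.1.1 ∘L ContinuousLinearMap.smulRightL ℝ (Coord 2) F (perp (q.2 0).1) ∘L s
  have hT0 : T (j, e) = 1 := by ext d; exact hs' d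
  have hTc : ContinuousAt T (j, e) := by
    have c1 : ContinuousAt (fun q : J1 2 F × (Fin 1 → J1 2 F) => σ q.1.1) (j, e) :=
      ContinuousAt.comp (f := fun q : J1 2 F × (Fin 1 → J1 2 F) => q.1.1)
        (H.contDiffOn_σ.contDiffAt (H.isOpen.mem_nhds hj)).continuousAt (by fun_prop)
    have c2 : Continuous fun q : J1 2 F × (Fin 1 → J1 2 F) =>
        ContinuousLinearMap.smulRightL ℝ (Coord 2) F (perp (q.2 0).1) ∘L s := by fun_prop
    exact c1.clm_comp c2.continuousAt
  have h1 : ∀ᶠ q in 𝓝 (j, e), IsUnit (T q) := by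
    have : CompleteSpace W₀ := FiniteDimensional.complete ℝ W₀
    refine hTc.eventually (Units.isOpen.mem_nhds ?_)
    rw [hT0]
    exact isUnit_one
  have h2 : ∀ᶠ q : J1 2 F × (Fin 1 → J1 2 F) in 𝓝 (j, e), q.1.1 ∈ U :=
    continuousAt_fst.eventually (H.eventually_mem hj)
  have h3 : ∀ᶠ q : J1 2 F × (Fin 1 → J1 2 F) in 𝓝 (j, e), (q.2 0).1 ≠ 0 := by
    have : Continuous fun q : J1 2 F × (Fin 1 → J1 2 F) => (q.2 0).1 := by fun_prop
    exact this.continuousAt.eventually_ne he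
  filter_upwards [h1, h2, h3] with q hq1 hq2 hq3 _
  rw [H.polarRank_one hj e he hs, H.polarRank_one hq2 q.2 hq3]
  intro c
  obtain ⟨d, hd⟩ := isUnit_surjective hq1 c
  exact ⟨s d, hd⟩

theorem isInInvolution [FiniteDimensional ℝ F] [FiniteDimensional ℝ W₀]
    (H : IsNormalSystem U Φ ι f a σ) : IsInInvolution U Φ := by
  intro j hj
  obtain ⟨-, D, hD, hDv⟩ := H.exists_fderiv_eq hj
  obtain ⟨y, hy, hs⟩ := H.normal _ hj
  obtain ⟨z, η, hyz, hηy, hηz, hdec⟩ := exists_dual_frame hy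
  obtain ⟨p, hp⟩ := hs (-D (y, j.2.2 y, 0))
  obtain ⟨q, hq⟩ := hs (-D (z, j.2.2 z, 0) - σ j.1 (η.smulRight p))
  change σ j.1 ((perp y).smulRight p) = _ at hp
  change σ j.1 ((perp y).smulRight q) = _ at hq
  -- second derivatives `0`, `p`, `q` in the frame `y`, `z`
  set e₁ : J1 2 F := (y, j.2.2 y, (perp y).smulRight p) with he₁
  set e₂ : J1 2 F := (z, j.2.2 z, η.smulRight p + (perp y).smulRight q) with he₂
  have hD1 : D e₁ = 0 := by
    have : e₁ = (y, j.2.2 y, 0) + (0, 0, (perp y).smulRight p) := by simp [he₁]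
    rw [this, map_add, hDv, hp, map_zero, zero_add, add_neg_cancel]
  have hD2 : D e₂ = 0 := by
    have : e₂ = (z, j.2.2 z, 0) + (0, 0, η.smulRight p + (perp y).smulRight q) := by simp [he₂]
    rw [this, map_add, hDv, map_add, hq, map_zero]
    abel
  have hx : LinearIndependent ℝ fun i => (![e₁, e₂] i).1 := by
    have : (fun i => (![e₁, e₂] i).1) = ![y, z] := by
      ext i : 1; fin_cases i <;> rfl
    rw [this, LinearIndependent.pair_iff]
    intro s t h
    have ha := congrArg η h
    have hb := congrArg (perp y) h
    simp [hyz, hηy, hηz, perp_self] at ha hb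
    exact ⟨ha, hb⟩
  have hli : LinearIndependent ℝ ![e₁, e₂] :=
    LinearIndependent.of_comp (LinearMap.fst ℝ (Coord 2) (F × (Coord 2 →L[ℝ] F))) hx
  have hint : IsIntegralFrame (pfaffForm Φ) j ![e₁, e₂] := by
    refine (H.isIntegralFrame_iff hj hD _).2 ⟨hli, fun i => ?_, fun i i' => ?_⟩
    · fin_cases i
      · exact ⟨hD1, sub_self _⟩
      · exact ⟨hD2, sub_self _⟩
    · fin_cases i <;> fin_cases i' <;> simp [he₁, he₂, hyz, hηy, hηz, perp_self]
  refine ⟨![e₁, e₂], ⟨hint, fun k => ?_⟩, hx⟩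
  fin_cases k
  · exact H.isRegularFrame_zero hj _
  · have he : initialFrame ![e₁, e₂] 1 = fun _ : Fin 1 => e₁ := by
      funext i
      obtain rfl : i = (0 : Fin 1) := Subsingleton.elim (α := Fin 1) _ _
      rfl
    change IsRegularFrame (pfaffForm Φ) j (k := 1) (initialFrame ![e₁, e₂] 1)
    rw [he]
    refine H.isRegularFrame_one (e := fun _ => e₁) hj hy ?_ hs
    exact (H.isIntegralFrame_iff hj hD _).2 ⟨linearIndependent_singleton_of_fst_ne_zero hy,
      fun i => ⟨hD1, sub_self _⟩, fun i i' => sub_self _⟩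

theorem hasCartanCharacters [FiniteDimensional ℝ F] [FiniteDimensional ℝ W₀]
    (H : IsNormalSystem U Φ ι f a σ) :
    HasCartanCharacters U Φ ![(Module.finrank ℝ W₀ : ℤ) + Module.finrank ℝ F,
      Module.finrank ℝ F, (Module.finrank ℝ F : ℤ) - Module.finrank ℝ W₀] := by
  rintro j hj e ⟨⟨hint, hreg⟩, hx⟩ k
  have h0 : polarRank (pfaffForm Φ) j (initialFrame e 0) = _ := H.polarRank_zero hj _
  have h1 : polarRank (pfaffForm Φ) j (initialFrame e 1) = _ :=
    H.polarRank_of_isRegularFrame (e := fun i => e (i.castLE (by norm_num))) hj (hx.ne_zero 0)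
      (hreg 1)
  have h2 : polarRank (pfaffForm Φ) j (initialFrame e 2) = _ := H.polarRank_two hj e hint hx
  fin_cases k
  · change (polarRank (pfaffForm Φ) j (initialFrame e 0) : ℤ) = _
    rw [h0]; simp
  · change (polarRank (pfaffForm Φ) j (initialFrame e 1) : ℤ) -
      polarRank (pfaffForm Φ) j (initialFrame e 0) = _
    rw [h0, h1]; simp; ring
  · change (polarRank (pfaffForm Φ) j (initialFrame e 2) : ℤ) -
      polarRank (pfaffForm Φ) j (initialFrame e 1) = _
    rw [h1, h2]; simp; ring

end IsNormalSystem

end Pfaff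

/-! ### Partial derivatives and the curvature of a metric -/

section Curvature

variable {n : ℕ} {U : Set (Coord n)}

theorem contDiffOn_partialD (hU : IsOpen U) {f : Coord n → ℝ} (hf : ContDiffOn ℝ ∞ f U)
    (i : Fin n) : ContDiffOn ℝ ∞ (partialD i f) U :=
  (hf.fderiv_of_isOpen hU (by simp)).clm_apply contDiffOn_const

theorem partialD_congr {f h : Coord n → ℝ} {x : Coord n} (he : f =ᶠ[𝓝 x] h) (i : Fin n) :
    partialD i f x = partialD i h x := by
  rw [partialD, he.fderiv_eq]; rfl

theorem partialD_sum_mul {f h : Fin n → Coord n → ℝ} {x : Coord n}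
    (hf : ∀ e, DifferentiableAt ℝ (f e) x) (hh : ∀ e, DifferentiableAt ℝ (h e) x) (i : Fin n) :
    partialD i (fun y => ∑ e, f e y * h e y) x =
      ∑ e, (partialD i (f e) x * h e x + f e x * partialD i (h e) x) := by
  have : HasFDerivAt (fun y => ∑ e, f e y * h e y)
      (∑ e, (f e x • fderiv ℝ (h e) x + h e x • fderiv ℝ (f e) x)) x :=
    HasFDerivAt.fun_sum fun e _ => (hf e).hasFDerivAt.mul (hh e).hasFDerivAt
  rw [partialD, this.fderiv, sum_apply]
  refine Finset.sum_congr rfl fun e _ => ?_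
  simp only [add_apply, smul_apply, smul_eq_mul, partialD]
  ring

theorem partialD_comm (hU : IsOpen U) {f : Coord n → ℝ} (hf : ContDiffOn ℝ ∞ f U) {x : Coord n}
    (hx : x ∈ U) (i j : Fin n) :
    partialD i (partialD j f) x = partialD j (partialD i f) x := by
  have hfx := hf.contDiffAt (hU.mem_nhds hx)
  have hd : DifferentiableAt ℝ (fderiv ℝ f) x :=
    (hfx.fderiv_right (m := ∞) (by simp)).differentiableAt (by simp)
  have hs : IsSymmSndFDerivAt ℝ f x := (contDiffAt_infty.1 hfx 2).isSymmSndFDerivAt (by simp)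
  have key : ∀ i j, partialD i (partialD j f) x =
      fderiv ℝ (fderiv ℝ f) x (Pi.single i 1) (Pi.single j 1) := by
    intro i j
    have := (hd.hasFDerivAt.clm_apply (hasFDerivAt_const (Pi.single j (1 : ℝ)) x)).fderiv
    unfold partialD
    rw [this]
    simp
  rw [key, key, hs.eq]

variable {g : Coord n → Matrix (Fin n) (Fin n) ℝ}

/-- The Christoffel symbols of the first kind, `Γ_{abc} = g_{ae} Γ^e_{bc}`. -/
def christoffelLow (g : Coord n → Matrix (Fin n) (Fin n) ℝ) (a b c : Fin n) (x : Coord n) : ℝ :=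
  (partialD b (fun y => g y a c) x + partialD c (fun y => g y a b) x
    - partialD a (fun y => g y b c) x) / 2

namespace IsMetricOn

theorem partialD_symm (hg : IsMetricOn g U) {x : Coord n} (hx : x ∈ U) (i a b : Fin n) :
    partialD i (fun y => g y a b) x = partialD i (fun y => g y b a) x := by
  refine partialD_congr ?_ i
  filter_upwards [hg.isOpen.mem_nhds hx] with y hy
  exact (hg.symm y hy).apply b a

theorem contDiffOn_partialD_metric (hg : IsMetricOn g U) (i a b : Fin n) :
    ContDiffOn ℝ ∞ (partialD i fun y => g y a b) U :=
  contDiffOn_partialD hg.isOpen (hg.smooth a b) i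

theorem contDiffOn_christoffelLow (hg : IsMetricOn g U) (a b c : Fin n) :
    ContDiffOn ℝ ∞ (christoffelLow g a b c) U :=
  (((hg.contDiffOn_partialD_metric _ _ _).add (hg.contDiffOn_partialD_metric _ _ _)).sub
    (hg.contDiffOn_partialD_metric _ _ _)).div_const 2

theorem sum_mul_christoffel (hg : IsMetricOn g U) {x : Coord n} (hx : x ∈ U) (a b c : Fin n) :
    ∑ e, g x a e * christoffel g e b c x = christoffelLow g a b c x := by
  have hinv : g x * (g x)⁻¹ = 1 :=
    Matrix.mul_nonsing_inv _ (isUnit_iff_ne_zero.2 (hg.nondegenerate x hx))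
  have hX : ∀ e, christoffel g e b c x = ∑ d, (g x)⁻¹ e d * christoffelLow g d b c x := fun e =>
    Finset.sum_congr rfl fun d _ => by rw [christoffelLow]; ring
  have h2 : ((g x * (g x)⁻¹).mulVec fun d => christoffelLow g d b c x) a =
      christoffelLow g a b c x := by rw [hinv, Matrix.one_mulVec]
  rw [← Matrix.mulVec_mulVec] at h2
  rw [← h2]
  exact Finset.sum_congr rfl fun e _ => by rw [hX]; rfl

theorem christoffel_symm (hg : IsMetricOn g U) {x : Coord n} (hx : x ∈ U) (a b c : Fin n) :
    christoffel g a b c x = christoffel g a c b x :=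
  Finset.sum_congr rfl fun d _ => by rw [hg.partialD_symm hx d b c]; ring

/-- Metric compatibility: `∂_c g_{ab} = Γ_{acb} + Γ_{bca}`. -/
theorem partialD_metric (hg : IsMetricOn g U) {x : Coord n} (hx : x ∈ U) (a b c : Fin n) :
    partialD c (fun y => g y a b) x = christoffelLow g a c b x + christoffelLow g b c a x := by
  rw [christoffelLow, christoffelLow, hg.partialD_symm hx a b c, hg.partialD_symm hx b c a,
    hg.partialD_symm hx c b a]
  ring

end IsMetricOn

end Curvature

section Plane

variable {U : Set (Coord 2)} {g : Coord 2 → Matrix (Fin 2) (Fin 2) ℝ}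

namespace IsMetricOn

theorem contDiffOn_inv (hg : IsMetricOn g U) (a b : Fin 2) :
    ContDiffOn ℝ ∞ (fun x => (g x)⁻¹ a b) U := by
  have hdet : ContDiffOn ℝ ∞ (fun x => ((g x).det)⁻¹) U := by
    refine ContDiffOn.inv ?_ hg.nondegenerate
    simp only [Matrix.det_fin_two]
    exact ((hg.smooth 0 0).mul (hg.smooth 1 1)).sub ((hg.smooth 0 1).mul (hg.smooth 1 0))
  have hadj : ContDiffOn ℝ ∞ (fun x => (g x).adjugate a b) U := by
    simp only [Matrix.adjugate_fin_two]
    fin_cases a <;> fin_cases b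
    · exact hg.smooth 1 1
    · exact (hg.smooth 0 1).neg
    · exact (hg.smooth 1 0).neg
    · exact hg.smooth 0 0
  refine (hdet.mul hadj).congr fun x _ => ?_
  simp [Matrix.inv_def]

theorem contDiffOn_christoffel (hg : IsMetricOn g U) (a b c : Fin 2) :
    ContDiffOn ℝ ∞ (christoffel g a b c) U :=
  ContDiffOn.sum fun d _ => ((hg.contDiffOn_inv a d).div_const 2).mul
    (((hg.contDiffOn_partialD_metric _ _ _).add (hg.contDiffOn_partialD_metric _ _ _)).sub
      (hg.contDiffOn_partialD_metric _ _ _))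

theorem contDiffOn_riemann (hg : IsMetricOn g U) (a b c d : Fin 2) :
    ContDiffOn ℝ ∞ (riemann g a b c d) U := by
  have hΓ := hg.contDiffOn_christoffel
  exact ContDiffOn.sum fun e _ => (hg.smooth a e).mul
    (((contDiffOn_partialD hg.isOpen (hΓ _ _ _) _).sub
      (contDiffOn_partialD hg.isOpen (hΓ _ _ _) _)).add
    (ContDiffOn.sum fun e' _ => ((hΓ _ _ _).mul (hΓ _ _ _)).sub ((hΓ _ _ _).mul (hΓ _ _ _))))

/-- The curvature in terms of `∂_c Γ_{abd}` and a quadratic expression in the Christoffel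
symbols. -/
theorem riemann_eq (hg : IsMetricOn g U) {x : Coord 2} (hx : x ∈ U) (a b c d : Fin 2) :
    riemann g a b c d x = partialD c (christoffelLow g a b d) x -
      partialD d (christoffelLow g a b c) x -
      ∑ e, (christoffelLow g e c a x * christoffel g e b d x -
        christoffelLow g e d a x * christoffel g e b c x) := by
  have hU := hg.isOpen.mem_nhds hx
  have key : ∀ b c d, partialD d (christoffelLow g a b c) x =
      ∑ e, (partialD d (fun y => g y a e) x * christoffel g e b c x +
        g x a e * partialD d (christoffel g e b c) x) := by
    intro b c d
    rw [← partialD_sum_mul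
      (fun e => ((hg.smooth a e).contDiffAt hU).differentiableAt (by simp))
      (fun e => ((hg.contDiffOn_christoffel e b c).contDiffAt hU).differentiableAt (by simp))]
    refine partialD_congr ?_ d
    filter_upwards [hU] with y hy
    exact (hg.sum_mul_christoffel hy a b c).symm
  have q1 := hg.sum_mul_christoffel hx a c 0
  have q2 := hg.sum_mul_christoffel hx a c 1
  have q3 := hg.sum_mul_christoffel hx a d 0
  have q4 := hg.sum_mul_christoffel hx a d 1
  rw [key, key]
  simp only [riemann, riemannUp, Fin.sum_univ_two, hg.partialD_metric hx] at q1 q2 q3 q4 ⊢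
  linear_combination christoffel g 0 b d x * q1 + christoffel g 1 b d x * q2 -
    christoffel g 0 b c x * q3 - christoffel g 1 b c x * q4

/-- The antisymmetry in the first pair of indices, which rests on metric compatibility and the
symmetry of the second derivatives of the metric. -/
theorem riemann_antisymm_left (hg : IsMetricOn g U) {x : Coord 2} (hx : x ∈ U)
    (a b c d : Fin 2) : riemann g a b c d x = -riemann g b a c d x := by
  have hU := hg.isOpen.mem_nhds hx
  have hd : ∀ a b c, DifferentiableAt ℝ (christoffelLow g a b c) x := fun a b c =>
    ((hg.contDiffOn_christoffelLow a b c).contDiffAt hU).differentiableAt (by simp)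
  have hsum : ∀ c d, partialD c (partialD d fun y => g y a b) x =
      partialD c (christoffelLow g a d b) x + partialD c (christoffelLow g b d a) x := by
    intro c d
    have : partialD c (fun y => christoffelLow g a d b y + christoffelLow g b d a y) x =
        partialD c (christoffelLow g a d b) x + partialD c (christoffelLow g b d a) x := by
      unfold partialD
      rw [fderiv_fun_add (hd a d b) (hd b d a)]
      rfl
    rw [← this]
    refine partialD_congr ?_ c
    filter_upwards [hU] with y hy
    exact hg.partialD_metric hy a b d
  have hlow : ∀ a b c, ∀ y ∈ U, christoffelLow g a b c y = christoffelLow g a c b y := by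
    intro a b c y hy
    rw [christoffelLow, christoffelLow, hg.partialD_symm hy a b c]
    ring
  have hlow' : ∀ i a b c, partialD i (christoffelLow g a b c) x =
      partialD i (christoffelLow g a c b) x := by
    intro i a b c
    refine partialD_congr ?_ i
    filter_upwards [hU] with y hy using hlow a b c y hy
  have hcomm := partialD_comm hg.isOpen (hg.smooth a b) hx c d
  rw [hsum, hsum, hlow' c a d b, hlow' c b d a, hlow' d a c b, hlow' d b c a] at hcomm
  have hs : g x 0 1 = g x 1 0 := (hg.symm x hx).apply 1 0
  rw [hg.riemann_eq hx, hg.riemann_eq hx]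
  simp only [← hg.sum_mul_christoffel hx, Fin.sum_univ_two, hg.christoffel_symm hx _ c,
    hg.christoffel_symm hx _ d, hs]
  linear_combination hcomm

end IsMetricOn

theorem riemann_antisymm_right (g : Coord 2 → Matrix (Fin 2) (Fin 2) ℝ) (a b c d : Fin 2)
    (x : Coord 2) : riemann g a b c d x = -riemann g a b d c x := by
  simp only [riemann, riemannUp, Fin.sum_univ_two]
  ring

/-! ### Curl and divergence operators

The operators below act on functions with values in a space `F` that carries two coordinates
`ℓ 0`, `ℓ 1`; for Lanczos tensors these are the components `L_{010}`, `L_{011}`. -/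

section CurlDiv

variable {F : Type} [NormedAddCommGroup F] [NormedSpace ℝ F] (ℓ : Fin 2 → F →L[ℝ] ℝ)

/-- The part of order zero of `L_{01c;d}`, with `ℓ c` in place of `L_{01c}`. -/
def covZeroth (g : Coord 2 → Matrix (Fin 2) (Fin 2) ℝ) (c d : Fin 2) (x : Coord 2) : F →L[ℝ] ℝ :=
  -((christoffel g 0 0 d x + christoffel g 1 1 d x) • ℓ c +
    (christoffel g 0 c d x • ℓ 0 + christoffel g 1 c d x • ℓ 1))

/-- The part of order one of `L_{01c;d}`, with `ℓ c` in place of `L_{01c}`. -/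
def covFirst (c d : Fin 2) : (Coord 2 →L[ℝ] F) →L[ℝ] ℝ :=
  ℓ c ∘L ContinuousLinearMap.apply ℝ F (Pi.single d 1)

/-- The part of `R_{0101} - 2 (L_{010;1} - L_{011;0})` that is linear of order zero in `L`. -/
def lanczosZeroth (g : Coord 2 → Matrix (Fin 2) (Fin 2) ℝ) (x : Coord 2) : F →L[ℝ] ℝ :=
  (-2 : ℝ) • (covZeroth ℓ g 0 1 x - covZeroth ℓ g 1 0 x)

/-- The symbol of the Riemann-Lanczos equation: a multiple of the curl. -/
def lanczosSymbol : (Coord 2 →L[ℝ] F) →L[ℝ] ℝ :=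
  (-2 : ℝ) • (covFirst ℓ 0 1 - covFirst ℓ 1 0)

/-- The part of order zero of the divergence `g^{st} L_{01s;t}`. -/
def gaugeZeroth (g : Coord 2 → Matrix (Fin 2) (Fin 2) ℝ) (x : Coord 2) : F →L[ℝ] ℝ :=
  ∑ s, ∑ t, (g x)⁻¹ s t • covZeroth ℓ g s t x

/-- The symbol of the divergence `g^{st} L_{01s;t}`. -/
def gaugeSymbol (g : Coord 2 → Matrix (Fin 2) (Fin 2) ℝ) (x : Coord 2) :
    (Coord 2 →L[ℝ] F) →L[ℝ] ℝ :=
  ∑ s, ∑ t, (g x)⁻¹ s t • covFirst ℓ s t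

theorem lanczosZeroth_apply (x : Coord 2) (v : F) : lanczosZeroth ℓ g x v =
    -2 * (covZeroth ℓ g 0 1 x v - covZeroth ℓ g 1 0 x v) := rfl

theorem lanczosSymbol_apply (A : Coord 2 →L[ℝ] F) :
    lanczosSymbol ℓ A = -2 * (covFirst ℓ 0 1 A - covFirst ℓ 1 0 A) := rfl

theorem gaugeZeroth_apply (x : Coord 2) (v : F) : gaugeZeroth ℓ g x v =
    ∑ s, ∑ t, (g x)⁻¹ s t * covZeroth ℓ g s t x v := by
  simp [gaugeZeroth, Fin.sum_univ_two]

theorem gaugeSymbol_apply (x : Coord 2) (A : Coord 2 →L[ℝ] F) :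
    gaugeSymbol ℓ g x A = ∑ s, ∑ t, (g x)⁻¹ s t * covFirst ℓ s t A := by
  simp [gaugeSymbol, Fin.sum_univ_two]

theorem covFirst_perp (c d : Fin 2) (y : Coord 2) (v : F) :
    covFirst ℓ c d ((perp y).smulRight v) = perp y (Pi.single d 1) * ℓ c v := by
  simp [covFirst]

theorem contDiffOn_covZeroth (hg : IsMetricOn g U) (c d : Fin 2) :
    ContDiffOn ℝ ∞ (covZeroth ℓ g c d) U := by
  have hΓ := hg.contDiffOn_christoffel
  exact ((((hΓ 0 0 d).add (hΓ 1 1 d)).smul contDiffOn_const).add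
    (((hΓ 0 c d).smul contDiffOn_const).add ((hΓ 1 c d).smul contDiffOn_const))).neg

theorem contDiffOn_lanczosZeroth (hg : IsMetricOn g U) : ContDiffOn ℝ ∞ (lanczosZeroth ℓ g) U :=
  ((contDiffOn_covZeroth ℓ hg 0 1).sub (contDiffOn_covZeroth ℓ hg 1 0)).const_smul (-2 : ℝ)

theorem contDiffOn_sum_sum_smul {B : Type} [NormedAddCommGroup B] [NormedSpace ℝ B]
    {r : Fin 2 → Fin 2 → Coord 2 → ℝ} {v : Fin 2 → Fin 2 → Coord 2 → B}
    (hr : ∀ s t, ContDiffOn ℝ ∞ (r s t) U) (hv : ∀ s t, ContDiffOn ℝ ∞ (v s t) U) :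
    ContDiffOn ℝ ∞ (fun x => ∑ s, ∑ t, r s t x • v s t x) U :=
  ContDiffOn.sum fun s _ => ContDiffOn.sum fun t _ => (hr s t).smul (hv s t)

theorem contDiffOn_gaugeZeroth (hg : IsMetricOn g U) : ContDiffOn ℝ ∞ (gaugeZeroth ℓ g) U :=
  contDiffOn_sum_sum_smul hg.contDiffOn_inv fun s t => contDiffOn_covZeroth ℓ hg s t

theorem contDiffOn_gaugeSymbol (hg : IsMetricOn g U) : ContDiffOn ℝ ∞ (gaugeSymbol ℓ g) U :=
  contDiffOn_sum_sum_smul hg.contDiffOn_inv fun _ _ => contDiffOn_const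

theorem contDiffOn_clm_prod {A B C : Type} [NormedAddCommGroup A] [NormedSpace ℝ A]
    [NormedAddCommGroup B] [NormedSpace ℝ B] [NormedAddCommGroup C] [NormedSpace ℝ C]
    {p : Coord 2 → A →L[ℝ] B} {q : Coord 2 → A →L[ℝ] C} (hp : ContDiffOn ℝ ∞ p U)
    (hq : ContDiffOn ℝ ∞ q U) : ContDiffOn ℝ ∞ (fun x => (p x).prod (q x)) U := by
  have : (fun x => (p x).prod (q x)) = fun x => ContinuousLinearMap.inl ℝ B C ∘L p x +
      ContinuousLinearMap.inr ℝ B C ∘L q x :=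
    funext fun x => ContinuousLinearMap.ext fun v => by simp
  rw [this]
  exact (contDiffOn_const.clm_comp hp).add (contDiffOn_const.clm_comp hq)

theorem perp_single_zero (y : Coord 2) : perp y (Pi.single 0 1) = -y 1 := by
  simp [perp_apply]

theorem perp_single_one (y : Coord 2) : perp y (Pi.single 1 1) = y 0 := by
  simp [perp_apply]

variable {ℓ}

theorem exists_lanczosSymbol_surjective (hℓ : ∀ v : Fin 2 → ℝ, ∃ L, ∀ c, ℓ c L = v c) :
    ∃ y : Coord 2, y ≠ 0 ∧
      Function.Surjective fun v : F => lanczosSymbol ℓ ((perp y).smulRight v) := by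
  refine ⟨Pi.single 0 1, by simp, fun c => ?_⟩
  obtain ⟨L, hL⟩ := hℓ ![-c / 2, 0]
  refine ⟨L, ?_⟩
  simp only [lanczosSymbol_apply, covFirst_perp, perp_single_zero, perp_single_one, hL]
  simp
  ring

/-- A nonzero quadratic form takes a nonzero value. -/
theorem exists_quadratic_ne_zero {h : Matrix (Fin 2) (Fin 2) ℝ} (hs : h 0 1 = h 1 0)
    (hd : h.det ≠ 0) : ∃ y : Coord 2,
      y 0 * (y 0 * h 1 1 - y 1 * h 1 0) - y 1 * (y 0 * h 0 1 - y 1 * h 0 0) ≠ 0 := by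
  by_contra! H
  have h1 := H ![1, 0]
  have h2 := H ![0, 1]
  have h3 := H ![1, 1]
  simp at h1 h2 h3
  apply hd
  rw [Matrix.det_fin_two]
  have : h 0 1 = 0 := by linarith
  rw [h1, ← hs, this]
  ring

/-- The symbol of curl and divergence together has determinant a multiple of `g(ξ, ξ)` at the
covector `ξ`, so that all covectors but the null ones are noncharacteristic. -/
theorem exists_prod_symbol_surjective (hg : IsMetricOn g U) {x : Coord 2} (hx : x ∈ U)
    (hℓ : ∀ v : Fin 2 → ℝ, ∃ L, ∀ c, ℓ c L = v c) :
    ∃ y : Coord 2, y ≠ 0 ∧ Function.Surjective fun v : F =>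
      (lanczosSymbol ℓ).prod (gaugeSymbol ℓ g x) ((perp y).smulRight v) := by
  have hs : ((g x)⁻¹) 0 1 = ((g x)⁻¹) 1 0 := by
    have : ((g x)⁻¹).IsSymm := by
      rw [Matrix.IsSymm, Matrix.transpose_nonsing_inv, (hg.symm x hx).eq]
    exact this.apply 1 0
  have hd : ((g x)⁻¹).det ≠ 0 := by
    rw [Matrix.det_nonsing_inv, Ring.inverse_eq_inv']
    exact inv_ne_zero (hg.nondegenerate x hx)
  obtain ⟨y, hy⟩ := exists_quadratic_ne_zero hs hd
  set α₀ := y 0 * (g x)⁻¹ 0 1 - y 1 * (g x)⁻¹ 0 0 with hα₀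
  set α₁ := y 0 * (g x)⁻¹ 1 1 - y 1 * (g x)⁻¹ 1 0 with hα₁
  refine ⟨y, fun h => hy (by simp [h]), fun c => ?_⟩
  -- Cramer's rule for the equations `-2 (y₀ L₀ + y₁ L₁) = c₁` and `α₀ L₀ + α₁ L₁ = c₂`
  obtain ⟨L, hL⟩ := hℓ ![(-c.1 / 2 * α₁ - y 1 * c.2) / (y 0 * α₁ - y 1 * α₀),
    (y 0 * c.2 + c.1 / 2 * α₀) / (y 0 * α₁ - y 1 * α₀)]
  have hL0 := hL 0
  have hL1 := hL 1
  simp only [Matrix.cons_val_zero, Matrix.cons_val_one] at hL0 hL1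
  clear_value α₀ α₁
  refine ⟨L, Prod.ext ?_ ?_⟩
  · change lanczosSymbol ℓ ((perp y).smulRight L) = c.1
    rw [lanczosSymbol_apply, covFirst_perp, covFirst_perp, perp_single_zero, perp_single_one, hL0,
      hL1]
    field_simp
    ring
  · change gaugeSymbol ℓ g x ((perp y).smulRight L) = c.2
    have : gaugeSymbol ℓ g x ((perp y).smulRight L) = α₀ * ℓ 0 L + α₁ * ℓ 1 L := by
      simp only [gaugeSymbol_apply, Fin.sum_univ_two, covFirst_perp, perp_single_zero,
        perp_single_one, hα₀, hα₁]
      ring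
    rw [this, hL0, hL1, ← mul_div_assoc, ← mul_div_assoc, ← add_div, div_eq_iff hy]
    ring

end CurlDiv

/-! ### The Riemann-Lanczos equations as a normal system -/

/-- The alternating symbol in two dimensions. -/
def eps : Matrix (Fin 2) (Fin 2) ℝ := !![0, 1; -1, 0]

theorem eq_eps_mul {T : Fin 2 → Fin 2 → ℝ} (hT : ∀ a b, T a b = -T b a) (a b : Fin 2) :
    T a b = eps a b * T 0 1 := by
  have h0 := hT 0 0
  have h1 := hT 1 1
  have h2 := hT 1 0
  fin_cases a <;> fin_cases b <;> simp [eps] <;> linarith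

theorem lanczosTensors_two_apply (L : lanczosTensors 2) (a b c : Fin 2) :
    L.1 a b c = eps a b * L.1 0 1 c :=
  eq_eps_mul (T := fun a b => L.1 a b c) (fun a b => L.2.1 a b c) a b

/-- The coordinates `L_{01c}` on the space of Lanczos tensors. -/
def lanczosCoord (c : Fin 2) : lanczosTensors 2 →L[ℝ] ℝ :=
  LinearMap.toContinuousLinearMap
    { toFun := fun L => L.1 0 1 c
      map_add' := fun _ _ => rfl
      map_smul' := fun _ _ => rfl }

theorem lanczosCoord_apply (c : Fin 2) (L : lanczosTensors 2) : lanczosCoord c L = L.1 0 1 c := rfl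

theorem exists_lanczosCoord_eq (v : Fin 2 → ℝ) :
    ∃ L : lanczosTensors 2, ∀ c, lanczosCoord c L = v c := by
  refine ⟨⟨fun a b c => eps a b * v c, fun a b c => ?_, fun a b c => ?_⟩, fun c => ?_⟩
  · fin_cases a <;> fin_cases b <;> simp [eps]
  · fin_cases a <;> fin_cases b <;> fin_cases c <;> simp [eps]
  · simp [lanczosCoord_apply, eps]

theorem finrank_lanczosTensors_two : Module.finrank ℝ (lanczosTensors 2) = 2 := by
  let T : lanczosTensors 2 →ₗ[ℝ] Fin 2 → ℝ := LinearMap.pi fun c => (lanczosCoord c).toLinearMap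
  have hinj : Function.Injective T := by
    rw [injective_iff_map_eq_zero]
    intro L hL
    ext a b c
    rw [lanczosTensors_two_apply L a b c, show L.1 0 1 c = 0 from congrFun hL c]
    simp
  have hsurj : Function.Surjective T := fun v =>
    (exists_lanczosCoord_eq v).imp fun L hL => funext hL
  rw [(LinearEquiv.ofBijective T ⟨hinj, hsurj⟩).finrank_eq, Module.finrank_fin_fun]

theorem covDerivLanczos_antisymm (g : Coord 2 → Matrix (Fin 2) (Fin 2) ℝ)
    (j : J1 2 (lanczosTensors 2)) (a b c d : Fin 2) :
    covDerivLanczos g j a b c d = -covDerivLanczos g j b a c d := by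
  simp only [covDerivLanczos, Fin.sum_univ_two]
  rw [(j.2.2 (Pi.single d 1)).2.1 a b c, j.2.1.2.1 b 0 c, j.2.1.2.1 b 1 c, j.2.1.2.1 a 0 c,
    j.2.1.2.1 a 1 c, j.2.1.2.1 a b 0, j.2.1.2.1 a b 1]
  ring

theorem covDerivLanczos_eq (g : Coord 2 → Matrix (Fin 2) (Fin 2) ℝ)
    (j : J1 2 (lanczosTensors 2)) (c d : Fin 2) :
    covDerivLanczos g j 0 1 c d = covZeroth lanczosCoord g c d j.1 j.2.1 +
      covFirst lanczosCoord c d j.2.2 := by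
  have h0 : j.2.1.1 0 0 c = 0 := by rw [lanczosTensors_two_apply]; simp [eps]
  have h1 : j.2.1.1 1 1 c = 0 := by rw [lanczosTensors_two_apply]; simp [eps]
  have h2 : covFirst lanczosCoord c d j.2.2 = (j.2.2 (Pi.single d 1)).1 0 1 c := rfl
  have h3 : covZeroth lanczosCoord g c d j.1 j.2.1 =
      -((christoffel g 0 0 d j.1 + christoffel g 1 1 d j.1) * j.2.1.1 0 1 c +
        (christoffel g 0 c d j.1 * j.2.1.1 0 1 0 + christoffel g 1 c d j.1 * j.2.1.1 0 1 1)) := rfl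
  simp only [covDerivLanczos, h2, h3, Fin.sum_univ_two, h0, h1]
  ring

/-- The tensor `ε_{ab} ε_{cd}` spans the tensors with the symmetries of the Riemann-Lanczos
equations. -/
def epsTensor : ℝ →L[ℝ] Fin 2 → Fin 2 → Fin 2 → Fin 2 → ℝ :=
  ContinuousLinearMap.smulRight (ContinuousLinearMap.id ℝ ℝ) fun a b c d => eps a b * eps c d

theorem epsTensor_apply (t : ℝ) (a b c d : Fin 2) :
    epsTensor t a b c d = t * (eps a b * eps c d) := rfl

theorem injective_epsTensor : Function.Injective epsTensor := fun s t h => by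
  simpa [epsTensor_apply, eps] using congrFun (congrFun (congrFun (congrFun h 0) 1) 0) 1

theorem riemannLanczos_eq (hg : IsMetricOn g U) {j : J1 2 (lanczosTensors 2)} (hj : j.1 ∈ U) :
    riemannLanczos g j =
      epsTensor (riemann g 0 1 0 1 j.1 + lanczosZeroth lanczosCoord g j.1 j.2.1 +
        lanczosSymbol lanczosCoord j.2.2) := by
  have hl : ∀ a b c d, riemannLanczos g j a b c d = -riemannLanczos g j b a c d := by
    intro a b c d
    simp only [riemannLanczos]
    rw [hg.riemann_antisymm_left hj a b, covDerivLanczos_antisymm g j a b c d,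
      covDerivLanczos_antisymm g j a b d c]
    ring
  have hr : ∀ a b c d, riemannLanczos g j a b c d = -riemannLanczos g j a b d c := by
    intro a b c d
    simp only [riemannLanczos]
    rw [riemann_antisymm_right g a b c d, covDerivLanczos_antisymm g j c d a b,
      covDerivLanczos_antisymm g j c d b a]
    ring
  have h01 : riemannLanczos g j 0 1 0 1 =
      riemann g 0 1 0 1 j.1 + lanczosZeroth lanczosCoord g j.1 j.2.1 +
        lanczosSymbol lanczosCoord j.2.2 := by
    simp only [riemannLanczos, covDerivLanczos_eq]
    rw [lanczosZeroth_apply, lanczosSymbol_apply]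
    ring
  ext a b c d
  rw [epsTensor_apply, ← h01, eq_eps_mul (T := fun a b => riemannLanczos g j a b c d)
    (fun a b => hl a b c d) a b, eq_eps_mul (T := fun c d => riemannLanczos g j 0 1 c d)
    (fun c d => hr 0 1 c d) c d]
  ring

/-- The Riemann-Lanczos equations amount to a single equation whose symbol is the curl. -/
theorem isNormalSystem_riemannLanczos (hg : IsMetricOn g U) :
    IsNormalSystem U (riemannLanczos g) epsTensor (riemann g 0 1 0 1)
      (lanczosZeroth lanczosCoord g) fun _ => lanczosSymbol lanczosCoord where
  isOpen := hg.isOpen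
  injective := injective_epsTensor
  eq _ hj := riemannLanczos_eq hg hj
  contDiffOn_f := hg.contDiffOn_riemann 0 1 0 1
  contDiffOn_a := contDiffOn_lanczosZeroth _ hg
  contDiffOn_σ := contDiffOn_const
  normal _ _ := exists_lanczosSymbol_surjective exists_lanczosCoord_eq

/-! ### The differential gauge -/

/-- The symbol `ε_{ab}` spans the antisymmetric tensors. -/
def epsGauge : ℝ →L[ℝ] Fin 2 → Fin 2 → ℝ :=
  ContinuousLinearMap.smulRight (ContinuousLinearMap.id ℝ ℝ) fun a b => eps a b

theorem epsGauge_apply (t : ℝ) (a b : Fin 2) : epsGauge t a b = t * eps a b := rfl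

theorem injective_epsGauge : Function.Injective epsGauge := fun s t h => by
  simpa [epsGauge_apply, eps] using congrFun (congrFun h 0) 1

theorem lanczosGauge_eq (g : Coord 2 → Matrix (Fin 2) (Fin 2) ℝ) (j : J1 2 (lanczosTensors 2)) :
    lanczosGauge g j = epsGauge (gaugeZeroth lanczosCoord g j.1 j.2.1 +
      gaugeSymbol lanczosCoord g j.1 j.2.2) := by
  have hl : ∀ a b, lanczosGauge g j a b = -lanczosGauge g j b a := by
    intro a b
    simp only [lanczosGauge, Fin.sum_univ_two, covDerivLanczos_antisymm g j a b]
    ring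
  have h01 : lanczosGauge g j 0 1 = gaugeZeroth lanczosCoord g j.1 j.2.1 +
      gaugeSymbol lanczosCoord g j.1 j.2.2 := by
    simp only [lanczosGauge, covDerivLanczos_eq]
    rw [gaugeZeroth_apply, gaugeSymbol_apply]
    simp only [Fin.sum_univ_two]
    ring
  ext a b
  rw [epsGauge_apply, ← h01, eq_eps_mul hl a b, mul_comm]

/-- In the differential gauge the symbol is the curl together with the divergence. -/
theorem isNormalSystem_riemannLanczosGauged (hg : IsMetricOn g U) :
    IsNormalSystem U (riemannLanczosGauged g) (epsTensor.prodMap epsGauge)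
      (fun x => (riemann g 0 1 0 1 x, 0))
      (fun x => (lanczosZeroth lanczosCoord g x).prod (gaugeZeroth lanczosCoord g x))
      fun x => (lanczosSymbol lanczosCoord).prod (gaugeSymbol lanczosCoord g x) where
  isOpen := hg.isOpen
  injective := injective_epsTensor.prodMap injective_epsGauge
  eq j hj := by
    rw [riemannLanczosGauged, riemannLanczos_eq hg hj, lanczosGauge_eq]
    refine Prod.ext rfl ?_
    change _ = epsGauge (0 + _ + _)
    rw [zero_add]
    rfl
  contDiffOn_f := (hg.contDiffOn_riemann 0 1 0 1).prodMk contDiffOn_const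
  contDiffOn_a := contDiffOn_clm_prod (contDiffOn_lanczosZeroth _ hg) (contDiffOn_gaugeZeroth _ hg)
  contDiffOn_σ := contDiffOn_clm_prod contDiffOn_const (contDiffOn_gaugeSymbol _ hg)
  normal _ hx := exists_prod_symbol_surjective hg hx exists_lanczosCoord_eq

end Plane

end

theorem mainTheorem1 (U : Set (Coord 2)) (g : Coord 2 → Matrix (Fin 2) (Fin 2) ℝ)
    (hg : IsMetricOn g U) :
    (IsInvolutiveSystem U (riemannLanczos g) ∧
      HasSymbolCharacters U (riemannLanczos g) ![2, 1] ∧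
      IsInInvolution U (riemannLanczos g) ∧
      HasCartanCharacters U (riemannLanczos g) ![3, 2, 1]) ∧
    (IsInvolutiveSystem U (riemannLanczosGauged g) ∧
      HasSymbolCharacters U (riemannLanczosGauged g) ![2, 0] ∧
      IsInInvolution U (riemannLanczosGauged g) ∧
      HasCartanCharacters U (riemannLanczosGauged g) ![4, 2, 0]) := by
  have hA := isNormalSystem_riemannLanczos hg
  have hB := isNormalSystem_riemannLanczosGauged hg
  refine ⟨⟨hA.isInvolutiveSystem, ?_, hA.isInInvolution, ?_⟩,
    hB.isInvolutiveSystem, ?_, hB.isInInvolution, ?_⟩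
  · simpa [finrank_lanczosTensors_two] using hA.hasSymbolCharacters
  · simpa [finrank_lanczosTensors_two] using hA.hasCartanCharacters
  · simpa [finrank_lanczosTensors_two, Module.finrank_prod] using hB.hasSymbolCharacters
  · simpa [finrank_lanczosTensors_two, Module.finrank_prod] using hB.hasCartanCharacters
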